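/- All graphs are finite, simple and undirected. For a graph $G$ and $A\subseteq V(G)$, $G[A]$ is the subgraph induced by $A$, $G-A=G[V(G)\setminus A]$, and $c(G)$ is the number of connected components of $G$; components are identified with their vertex sets. A graph is $4K_1$-free if it has no four pairwise non-adjacent vertices. A vertex cut of $G$ is a set $A\subset V(G)$ such that $G-A$ is disconnected; it is minimum if no vertex cut of $G$ has fewer vertices; an articulation point is a vertex $x$ such that $\{x\}$ is a vertex cut. The vertex connectivity of $G$ is $|V(G)|-1$ if $G$ is complete and the size of a minimum vertex cut otherwise; $G$ is 2-connected if its vertex connectivity is at least $2$. A Hamiltonian path is a path containing all vertices of the graph. Theorem 5. Let $G$ be a connected $4K_1$-free graph and let $u$ be a vertex of $G$. The graph $G$ has a Hamiltonian path starting in $u$ if and only if all of the following conditions are satisfied. (a) The graph $G$ has a Hamiltonian path. (b) The vertex $u$ is not an articulation point of $G$. (c) For every articulation point $x\neq u$ of $G$, with $Q_u$ the component of $G-\{x\}$ containing $u$: if $G[Q_u]$ is not 2-connected, then for every articulation point $y\neq u$ of $G[Q_u]$ there exists a vertex $v\in Q_u$ adjacent to $x$ such that $u$ and $v$ are in different components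 of $G[Q_u]-\{y\}$. (d) For every articulation point $x\neq u$ of $G$, with $Q_u$ the component of $G-\{x\}$ containing $u$: if $G[Q_u]$ is 2-connected, then there exists $v\in Q_u$ adjacent to $x$ such that $v\neq u$ and $\{u,v\}$ is not a minimum vertex cut in $G[Q_u]$. (e) There is no vertex $x$ such that $c(G-\{u,x\})\geq 3$. (f) If $G$ is 2-connected, then for all $x\ne y$ such that $\{x,y\}$ is a minimum vertex cut of $G$ with $c(G-\{x,y\})=2$, and every labelling $Q_1,Q_2$ of the two components of $G-\{x,y\}$ such that $Q_1$ is a clique: if all neighbours of $x$ in $Q_2$ are articulation points of $G[Q_2]$, then $u\neq y$. -/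

import Mathlib

namespace HamPath

variable {V : Type*}

/-- The graph `G - A` obtained by deleting a set `A` of vertices. -/
abbrev del (G : SimpleGraph V) (A : Set V) : SimpleGraph ↥(Aᶜ) := G.induce Aᶜ

/-- `G` is `k K₁`-free: the edgeless graph on `k` vertices is not an induced subgraph of `G`. -/
def IsKK1Free (k : ℕ) (G : SimpleGraph V) : Prop :=
  ¬ (⊥ : SimpleGraph (Fin k)).IsIndContained G

/-- The number `c(G)` of connected components of `G`. -/
noncomputable def numComponents (G : SimpleGraph V) : ℕ := Nat.card G.ConnectedComponent

/-- `Q` is (the vertex set of) a connected component of `G - A`. -/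
def IsComponentOfDel (G : SimpleGraph V) (A Q : Set V) : Prop :=
  ∃ C : (del G A).ConnectedComponent, Q = Subtype.val '' C.supp

/-- `u` and `v` lie in different connected components of `G - A`
(in particular, neither of them is in `A`). -/
def InDifferentComponents (G : SimpleGraph V) (A : Set V) (u v : V) : Prop :=
  ∃ (hu : u ∈ Aᶜ) (hv : v ∈ Aᶜ),
    (del G A).connectedComponentMk ⟨u, hu⟩ ≠ (del G A).connectedComponentMk ⟨v, hv⟩

/-- `A` is a vertex cut of `G`: the graph `G - A` is disconnected, that is, it has two vertices
that are not joined by a path. -/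
def IsVertexCut (G : SimpleGraph V) (A : Set V) : Prop := ¬ (del G A).Preconnected

/-- `v` is an articulation point of `G`: a vertex cut of size one. -/
def IsArticulationPoint (G : SimpleGraph V) (v : V) : Prop := IsVertexCut G {v}

/-- A minimum vertex cut of a (finite) graph: a vertex cut of smallest cardinality. -/
def IsMinVertexCut (G : SimpleGraph V) (A : Set V) : Prop :=
  IsVertexCut G A ∧ ∀ B : Set V, IsVertexCut G B → A.ncard ≤ B.ncard

open Classical in
/-- The vertex connectivity of a finite graph: `|V(G)| - 1` if `G` is complete, and otherwise the
cardinality of a minimum vertex cut. -/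
noncomputable def vertexConnectivity (G : SimpleGraph V) : ℕ :=
  if G = ⊤ then Nat.card V - 1
  else sInf {k : ℕ | ∃ A : Set V, IsVertexCut G A ∧ A.ncard = k}

/-- `G` is 2-connected. -/
def IsTwoConnected (G : SimpleGraph V) : Prop := 2 ≤ vertexConnectivity G

/-- `G` has a Hamiltonian path starting in the vertex `u`. -/
def HasHamPathFrom [DecidableEq V] (G : SimpleGraph V) (u : V) : Prop :=
  ∃ (v : V) (p : G.Walk u v), p.IsHamiltonian

/-- `G` has a Hamiltonian path. -/
def HasHamPath [DecidableEq V] (G : SimpleGraph V) : Prop :=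
  ∃ u : V, HasHamPathFrom G u

/-- If `G[Q_u]` is not 2-connected, where `Q_u` is the component containing `u` of `G - x` for an
articulation point `x ≠ u`, then for every articulation point `y ≠ u` of `G[Q_u]` some neighbour
`v ∈ Q_u` of `x` is separated from `u` by `y` in `G[Q_u]`. -/
def CondC (G : SimpleGraph V) (u : V) : Prop :=
  ∀ x : V, x ≠ u → IsArticulationPoint G x →
    ∀ Q : Set V, IsComponentOfDel G {x} Q → ∀ hu : u ∈ Q,
      ¬ IsTwoConnected (G.induce Q) →
        ∀ y : Q, y ≠ ⟨u, hu⟩ → IsArticulationPoint (G.induce Q) y →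
          ∃ v : Q, G.Adj x v ∧ InDifferentComponents (G.induce Q) {y} ⟨u, hu⟩ v

/-- If `G[Q_u]` is 2-connected, where `Q_u` is the component containing `u` of `G - x` for an
articulation point `x ≠ u`, then `x` has a neighbour `v ≠ u` in `Q_u` such that `{u, v}` is not a
minimum vertex cut of `G[Q_u]`. -/
def CondD (G : SimpleGraph V) (u : V) : Prop :=
  ∀ x : V, x ≠ u → IsArticulationPoint G x →
    ∀ Q : Set V, IsComponentOfDel G {x} Q → ∀ hu : u ∈ Q,
      IsTwoConnected (G.induce Q) →
        ∃ v : Q, G.Adj x v ∧ v ≠ ⟨u, hu⟩ ∧ ¬ IsMinVertexCut (G.induce Q) {⟨u, hu⟩, v}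

/-- No vertex `x` satisfies `c(G - {u, x}) ≥ 3`. -/
def CondE (G : SimpleGraph V) (u : V) : Prop :=
  ¬ ∃ x : V, 3 ≤ numComponents (del G {u, x})

/-- If `G` is 2-connected, `{x, y}` is a minimum vertex cut with `c(G - {x, y}) = 2`, the components
of `G - {x, y}` are `Q₁` and `Q₂`, `Q₁` is a clique, and all neighbours of `x` in `Q₂` are
articulation points of `G[Q₂]`, then `u ≠ y`. -/
def CondF (G : SimpleGraph V) (u : V) : Prop :=
  IsTwoConnected G →
    ∀ x y : V, x ≠ y → IsMinVertexCut G {x, y} → numComponents (del G {x, y}) = 2 →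
      ∀ Q₁ Q₂ : Set V, IsComponentOfDel G {x, y} Q₁ → IsComponentOfDel G {x, y} Q₂ → Q₁ ≠ Q₂ →
        G.IsClique Q₁ →
        (∀ w : Q₂, G.Adj x w → IsArticulationPoint (G.induce Q₂) w) →
          u ≠ y

end HamPath

/-! Necessity reads the conditions off a Hamiltonian path P from `u`. The part of P before an
articulation point `x` spans `Q_u` and ends at a neighbour of `x`, which gives (c) and (d). Deleting
`u` and one more vertex leaves at most two segments of P, which gives (e). If the two vertices
deleted are `u = y` and `x`, the segment lying in `Q₂` spans it and has an end next to `x`; the end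
of a Hamiltonian path is no articulation point, hence (f).

Sufficiency, with an articulation point `x`: cut the given Hamiltonian path at `x`. The side of `u`
is `Q_u`, the other side M is kept. A vertex of M is adjacent to nothing in `Q_u`, so `G[Q_u]` has
independence number at most two. It remains to find a Hamiltonian path of `G[Q_u]` from `u` to a
neighbour of `x` (`exists_isPathList_to`). If `G[Q_u]` has an articulation point, the part of a
Hamiltonian path behind it is a clique and can be reordered, and (c) supplies the end. If not, (d)
supplies an end that forms no cut with `u`.

Sufficiency, without articulation points: take a longest path P from `u` and a component H off P.
Exchange arguments in the style of Chvátal and Erdős (`IsLongest.eq_nil_of_touches`) show that H is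
attached to P only at `u` and one other vertex `s`. So `{s, u}` is a minimum cut, by (e) with two
components, one of them a clique `Q₁` inside H. By (f), `s` has a neighbour in `Q₂` from which a
Hamiltonian path of `G[Q₂]` starts, and `u`, `Q₁`, `s`, `Q₂` in this order form the desired path. -/

namespace HamPath
variable {V : Type*}

/-! ### Separation certified by sets closed under adjacency -/

section Separations

variable {G : SimpleGraph V} {A X : Set V} {u v : V}

/-- `X` is a union of connected components of `G - A`. -/
def IsClosedIn (G : SimpleGraph V) (A X : Set V) : Prop :=
  X ⊆ Aᶜ ∧ ∀ v ∈ X, ∀ w, G.Adj v w → w ∉ A → w ∈ X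

theorem IsClosedIn.mem_of_reachable (h : IsClosedIn G A X) {a b : ↥(Aᶜ)}
    (hab : (del G A).Reachable a b) (ha : (a : V) ∈ X) : (b : V) ∈ X := by
  obtain ⟨p⟩ := hab
  induction p with
  | nil => exact ha
  | @cons _ v _ hadj _ ih => exact ih (h.2 _ ha _ hadj v.2)

theorem isClosedIn_supp (C : (del G A).ConnectedComponent) :
    IsClosedIn G A (Subtype.val '' C.supp) := by
  refine ⟨?_, ?_⟩
  · rintro _ ⟨a, -, rfl⟩
    exact a.2
  · rintro _ ⟨a, ha, rfl⟩ w hw hwA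
    exact ⟨⟨w, hwA⟩, C.mem_supp_of_adj_mem_supp (v := ⟨w, hwA⟩) ha hw, rfl⟩

/-- One set closed under adjacency off `A` certifies a separation, and the component of `u` is such
a set. Later cut arguments only exhibit or use such an `X`. -/
theorem inDifferentComponents_iff :
    InDifferentComponents G A u v ↔
      u ∉ A ∧ v ∉ A ∧ ∃ X, IsClosedIn G A X ∧ u ∈ X ∧ v ∉ X := by
  constructor
  · rintro ⟨hu, hv, hne⟩
    refine ⟨hu, hv, _, isClosedIn_supp ((del G A).connectedComponentMk ⟨u, hu⟩),
      ⟨⟨u, hu⟩, rfl, rfl⟩, ?_⟩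
    rintro ⟨a, ha, rfl⟩
    exact hne ha.symm
  · rintro ⟨hu, hv, X, hX, huX, hvX⟩
    refine ⟨hu, hv, fun h => hvX ?_⟩
    exact hX.mem_of_reachable (SimpleGraph.ConnectedComponent.exact h) huX

theorem InDifferentComponents.symm (h : InDifferentComponents G A u v) :
    InDifferentComponents G A v u := by
  obtain ⟨hu, hv, hne⟩ := h
  exact ⟨hv, hu, hne.symm⟩

theorem isVertexCut_iff : IsVertexCut G A ↔ ∃ u v, InDifferentComponents G A u v := by
  simp only [IsVertexCut, SimpleGraph.Preconnected, InDifferentComponents]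
  push Not
  constructor
  · rintro ⟨⟨a, ha⟩, ⟨b, hb⟩, h⟩
    exact ⟨a, b, ha, hb, fun h' => h (SimpleGraph.ConnectedComponent.exact h')⟩
  · rintro ⟨a, b, ha, hb, h⟩
    exact ⟨⟨a, ha⟩, ⟨b, hb⟩, fun h' => h (SimpleGraph.ConnectedComponent.sound h')⟩

theorem isVertexCut_of_isClosedIn (hX : IsClosedIn G A X) (hu : u ∈ X) (hv : v ∉ A)
    (hvX : v ∉ X) : IsVertexCut G A :=
  isVertexCut_iff.2 ⟨u, v, inDifferentComponents_iff.2 ⟨hX.1 hu, hv, X, hX, hu, hvX⟩⟩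

theorem three_le_numComponents_iff [Finite V] :
    3 ≤ numComponents (del G A) ↔ ∃ a b c, InDifferentComponents G A a b ∧
      InDifferentComponents G A a c ∧ InDifferentComponents G A b c := by
  classical
  have := Fintype.ofFinite (del G A).ConnectedComponent
  rw [numComponents, Nat.card_eq_fintype_card, Nat.succ_le_iff, Fintype.two_lt_card_iff]
  constructor
  · rintro ⟨a, b, c, hab, hac, hbc⟩
    induction a using SimpleGraph.ConnectedComponent.ind with | _ a
    induction b using SimpleGraph.ConnectedComponent.ind with | _ b
    induction c using SimpleGraph.ConnectedComponent.ind with | _ c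
    exact ⟨a, b, c, ⟨a.2, b.2, hab⟩, ⟨a.2, c.2, hac⟩, ⟨b.2, c.2, hbc⟩⟩
  · rintro ⟨a, b, c, ⟨ha, hb, hab⟩, ⟨_, hc, hac⟩, ⟨_, _, hbc⟩⟩
    exact ⟨_, _, _, hab, hac, hbc⟩

theorem two_le_numComponents [Finite V] (h : IsVertexCut G A) : 2 ≤ numComponents (del G A) := by
  classical
  have := Fintype.ofFinite (del G A).ConnectedComponent
  obtain ⟨a, b, ha, hb, hab⟩ := isVertexCut_iff.1 h
  rw [numComponents, Nat.card_eq_fintype_card, Nat.succ_le_iff, Fintype.one_lt_card_iff]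
  exact ⟨_, _, hab⟩

theorem IsComponentOfDel.isClosedIn {Q : Set V} (h : IsComponentOfDel G A Q) :
    IsClosedIn G A Q := by
  obtain ⟨C, rfl⟩ := h
  exact isClosedIn_supp C

theorem IsComponentOfDel.nonempty {Q : Set V} (h : IsComponentOfDel G A Q) : Q.Nonempty := by
  obtain ⟨C, rfl⟩ := h
  exact C.nonempty_supp.image _

theorem IsComponentOfDel.subset {Q : Set V} (h : IsComponentOfDel G A Q)
    (hX : IsClosedIn G A X) (huQ : u ∈ Q) (huX : u ∈ X) : Q ⊆ X := by
  obtain ⟨C, rfl⟩ := h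
  obtain ⟨a, ha, rfl⟩ := huQ
  rintro _ ⟨b, hb, rfl⟩
  exact hX.mem_of_reachable (SimpleGraph.ConnectedComponent.exact (ha.trans hb.symm)) huX

theorem exists_isComponentOfDel (hu : u ∉ A) : ∃ Q, IsComponentOfDel G A Q ∧ u ∈ Q :=
  ⟨_, ⟨(del G A).connectedComponentMk ⟨u, hu⟩, rfl⟩, ⟨u, hu⟩, rfl, rfl⟩

theorem preconnected_iff_closed : G.Preconnected ↔
    ∀ X : Set V, (∀ v ∈ X, ∀ w, G.Adj v w → w ∈ X) → ∀ u ∈ X, ∀ v, v ∈ X := by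
  constructor
  · intro h X hX u hu v
    obtain ⟨p⟩ := h u v
    induction p with
    | nil => exact hu
    | cons hadj _ ih => exact ih (hX _ hu _ hadj)
  · intro h u v
    exact h {v | G.Reachable u v} (fun v hv w hvw => hv.trans hvw.reachable) u
      (SimpleGraph.Reachable.refl u) v

theorem IsComponentOfDel.preconnected {Q : Set V} (h : IsComponentOfDel G A Q) :
    (G.induce Q).Preconnected := by
  rw [preconnected_iff_closed]
  intro X hX u hu v
  have hcl : IsClosedIn G A (Subtype.val '' X) := by
    refine ⟨?_, ?_⟩
    · rintro _ ⟨a, -, rfl⟩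
      exact h.isClosedIn.1 a.2
    · rintro _ ⟨a, ha, rfl⟩ w hw hwA
      exact ⟨⟨w, h.isClosedIn.2 a a.2 w hw hwA⟩, hX a ha _ hw, rfl⟩
  obtain ⟨a, ha, hav⟩ := h.subset hcl u.2 ⟨u, hu, rfl⟩ v.2
  rwa [← Subtype.ext hav]

theorem not_isVertexCut_empty (h : G.Preconnected) : ¬ IsVertexCut G ∅ := by
  intro hc
  obtain ⟨u, v, h'⟩ := isVertexCut_iff.1 hc
  obtain ⟨-, -, X, hX, hu, hv⟩ := inDifferentComponents_iff.1 h'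
  exact hv (preconnected_iff_closed.1 h X (fun v hv w hw => hX.2 v hv w hw (by simp)) u hu v)

end Separations

/-! ### Paths as duplicate-free lists of vertices -/

section PathLists

variable {G : SimpleGraph V} {A X : Set V} {u v : V}

/-- The list `l` runs through the vertices of a path of `G`. -/
def IsPathList (G : SimpleGraph V) (l : List V) : Prop := l.IsChain G.Adj ∧ l.Nodup

theorem hasHamPathFrom_iff [DecidableEq V] :
    HasHamPathFrom G u ↔ ∃ l, IsPathList G l ∧ l.head? = some u ∧ ∀ v, v ∈ l := by
  constructor
  · rintro ⟨v, p, hp⟩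
    refine ⟨p.support, ⟨p.isChain_adj_support, hp.isPath.support_nodup⟩, ?_, hp.mem_support⟩
    rw [List.head?_eq_some_head p.support_ne_nil, p.head_support]
  · rintro ⟨l, ⟨hc, hn⟩, hh, hall⟩
    have hne : l ≠ [] := by rintro rfl; simp at hh
    rw [List.head?_eq_some_head hne, Option.some_inj] at hh
    subst hh
    refine ⟨_, SimpleGraph.Walk.ofSupport l hne hc, fun a => ?_⟩
    rw [SimpleGraph.Walk.support_ofSupport]
    exact List.count_eq_one_of_mem hn (hall a)

theorem isChain_reverse_adj {l : List V} : l.reverse.IsChain G.Adj ↔ l.IsChain G.Adj := by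
  simp only [List.isChain_reverse, G.adj_comm]

theorem IsPathList.reverse {l : List V} (h : IsPathList G l) : IsPathList G l.reverse :=
  ⟨isChain_reverse_adj.2 h.1, List.nodup_reverse.2 h.2⟩

theorem IsClosedIn.mem_of_isChain (h : IsClosedIn G A X) {l : List V} (hl : l.IsChain G.Adj)
    (hA : ∀ v ∈ l, v ∉ A) (hu : u ∈ l) (huX : u ∈ X) (hv : v ∈ l) : v ∈ X := by
  -- No edge off `A` crosses the boundary of `X`, so the list lies wholly inside or wholly outside.
  -- This form is symmetric, as `v` may come before `u`.
  have key : ∀ l : List V, l.IsChain G.Adj → (∀ v ∈ l, v ∉ A) →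
      ((∀ v ∈ l, v ∈ X) ∨ ∀ v ∈ l, v ∉ X) := by
    intro l
    induction l with
    | nil => simp
    | cons a l ih =>
      intro hl hA
      cases l with
      | nil => simpa using em (a ∈ X)
      | cons b l =>
        rw [List.isChain_cons_cons] at hl
        have haA : a ∉ A := hA a (by simp)
        have hbA : b ∉ A := hA b (by simp)
        rcases ih hl.2 (fun v hv => hA v (List.mem_cons_of_mem _ hv)) with h1 | h1
        · left
          intro v hv
          rcases List.mem_cons.1 hv with rfl | hv
          · exact h.2 b (h1 b (by simp)) _ hl.1.symm haA
          · exact h1 v hv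
        · right
          intro v hv
          rcases List.mem_cons.1 hv with rfl | hv
          · exact fun hvX => h1 b (by simp) (h.2 _ hvX _ hl.1 hbA)
          · exact h1 v hv
  rcases key l hl hA with h1 | h1
  · exact h1 v hv
  · exact absurd huX (h1 u hu)

theorem not_isVertexCut_of_isChain {l : List V} (hl : l.IsChain G.Adj)
    (h : ∀ v, v ∈ l ↔ v ∉ A) : ¬ IsVertexCut G A := by
  intro hc
  obtain ⟨u, v, h'⟩ := isVertexCut_iff.1 hc
  obtain ⟨huA, hvA, X, hX, hu, hv⟩ := inDifferentComponents_iff.1 h'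
  exact hv (hX.mem_of_isChain hl (fun v => (h v).1) ((h u).2 huA) hu ((h v).2 hvA))

/-- Each list stays in one component, so among three vertices two share a list and hence a
component. -/
theorem not_three_le_numComponents_of_isChain [Finite V] {l₁ l₂ : List V}
    (h₁ : l₁.IsChain G.Adj) (h₂ : l₂.IsChain G.Adj) (h : ∀ v, v ∈ l₁ ∨ v ∈ l₂ ↔ v ∉ A) :
    ¬ 3 ≤ numComponents (del G A) := by
  rw [three_le_numComponents_iff]
  have key : ∀ a b, InDifferentComponents G A a b →
      ¬ (a ∈ l₁ ∧ b ∈ l₁) ∧ ¬ (a ∈ l₂ ∧ b ∈ l₂) := by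
    intro a b hab
    obtain ⟨-, -, X, hX, ha, hb⟩ := inDifferentComponents_iff.1 hab
    exact ⟨fun ⟨h1, h2⟩ => hb (hX.mem_of_isChain h₁ (fun v hv => (h v).1 (.inl hv)) h1 ha h2),
      fun ⟨h1, h2⟩ => hb (hX.mem_of_isChain h₂ (fun v hv => (h v).1 (.inr hv)) h1 ha h2)⟩
  rintro ⟨a, b, c, hab, hac, hbc⟩
  have ha := (h a).2 (inDifferentComponents_iff.1 hab).1
  have hb := (h b).2 (inDifferentComponents_iff.1 hbc).1
  have hc := (h c).2 (inDifferentComponents_iff.1 hbc).2.1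
  have := key _ _ hab
  have := key _ _ hac
  have := key _ _ hbc
  tauto

theorem IsPathList.exists_lift {Q : Set V} {l : List V} (h : IsPathList G l)
    (hQ : ∀ v, v ∈ l ↔ v ∈ Q) : ∃ l' : List Q, l'.map Subtype.val = l ∧
      IsPathList (G.induce Q) l' ∧ ∀ v, v ∈ l' := by
  refine ⟨l.attachWith (· ∈ Q) fun v hv => (hQ v).1 hv, by simp, ⟨?_, ?_⟩, ?_⟩
  · have := h.1
    rw [← List.attachWith_map_subtype_val (p := (· ∈ Q)) (fun v hv => (hQ v).1 hv),
      List.isChain_map] at this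
    exact this
  · refine List.Nodup.of_map Subtype.val ?_
    simpa using h.2
  · intro v
    simp [List.mem_attachWith, hQ]

theorem IsPathList.map_val {Q : Set V} {l : List Q} (h : IsPathList (G.induce Q) l) :
    IsPathList G (l.map Subtype.val) :=
  ⟨(List.isChain_map _).2 h.1, h.2.map Subtype.val_injective⟩

theorem not_isArticulationPoint_of_head? {l : List V} (hl : IsPathList G l) (hall : ∀ v, v ∈ l)
    (hu : l.head? = some u) : ¬ IsArticulationPoint G u := by
  cases l with
  | nil => simp at hu
  | cons a l =>
    obtain rfl : a = u := by simpa using hu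
    refine not_isVertexCut_of_isChain (l := l) hl.1.tail fun v => ?_
    have := (List.nodup_cons.1 hl.2).1
    have := hall v
    simp only [List.mem_cons, Set.mem_singleton_iff] at *
    constructor
    · rintro hv rfl
      contradiction
    · tauto

theorem not_isArticulationPoint_of_getLast? {l : List V} (hl : IsPathList G l)
    (hall : ∀ v, v ∈ l) (hu : l.getLast? = some u) : ¬ IsArticulationPoint G u :=
  not_isArticulationPoint_of_head? hl.reverse (by simpa using hall) (by simpa using hu)

end PathLists

/-! ### Two-connectedness without the infimum -/

section TwoConnected

variable {G : SimpleGraph V}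

theorem not_isVertexCut_top (A : Set V) : ¬ IsVertexCut (⊤ : SimpleGraph V) A := by
  intro h
  refine h fun a b => ?_
  by_cases hab : a = b
  · rw [hab]
  · exact SimpleGraph.Adj.reachable (by simpa [Subtype.ext_iff] using hab)

theorem isVertexCut_compl_pair {a b : V} (hab : a ≠ b) (hadj : ¬ G.Adj a b) :
    IsVertexCut G ({a, b}ᶜ) := by
  refine isVertexCut_of_isClosedIn (X := {a}) (u := a) (v := b) ⟨by simp, ?_⟩ rfl (by simp)
    (by simpa using hab.symm)
  rintro v rfl w hw hwA
  simp only [Set.mem_compl_iff, Set.mem_insert_iff, Set.mem_singleton_iff, not_not] at hwA ⊢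
  rcases hwA with rfl | rfl
  · rfl
  · exact absurd hw hadj

theorem isTwoConnected_iff [Finite V] :
    IsTwoConnected G ↔ G.Preconnected ∧ 3 ≤ Nat.card V ∧ ∀ v, ¬ IsArticulationPoint G v := by
  classical
  unfold IsTwoConnected vertexConnectivity
  split_ifs with h
  · subst h
    constructor
    · intro h
      exact ⟨SimpleGraph.preconnected_top, by omega, fun v => not_isVertexCut_top _⟩
    · rintro ⟨-, h, -⟩
      omega
  · obtain ⟨a, b, hab, hadj⟩ : ∃ a b, a ≠ b ∧ ¬ G.Adj a b := by
      by_contra! hcon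
      exact h (by ext a b; simpa using ⟨fun h => h.ne, hcon a b⟩)
    -- Nonemptiness excludes the default value `sInf ∅ = 0`.
    have hne : {k : ℕ | ∃ A : Set V, IsVertexCut G A ∧ A.ncard = k}.Nonempty :=
      ⟨_, _, isVertexCut_compl_pair hab hadj, rfl⟩
    constructor
    · intro h2
      have hmin : ∀ A : Set V, IsVertexCut G A → 2 ≤ A.ncard := fun A hA =>
        h2.trans (Nat.sInf_le ⟨A, hA, rfl⟩)
      refine ⟨?_, ?_, ?_⟩
      · by_contra hcon
        rw [preconnected_iff_closed] at hcon
        push Not at hcon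
        obtain ⟨X, hX, u, hu, v, hv⟩ := hcon
        have := hmin ∅ (isVertexCut_of_isClosedIn (X := X) (u := u) (v := v)
          ⟨by simp, fun v hv w hw _ => hX v hv w hw⟩ hu (by simp) hv)
        simp at this
      · have h1 := hmin _ (isVertexCut_compl_pair hab hadj)
        have h2 := Set.ncard_add_ncard_compl {a, b}
        rw [Set.ncard_pair hab] at h2
        omega
      · intro v hv
        simpa using hmin _ hv
    · rintro ⟨hc, -, hart⟩
      refine le_csInf hne ?_
      rintro _ ⟨A, hA, rfl⟩
      by_contra! hlt
      obtain h0 | h1 : A.ncard = 0 ∨ A.ncard = 1 := by omega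
      · rw [Set.ncard_eq_zero] at h0
        subst h0
        exact not_isVertexCut_empty hc hA
      · obtain ⟨v, rfl⟩ := Set.ncard_eq_one.1 h1
        exact hart v hA

/-- Sets with fewer than two vertices cannot cut, so for pairs in a 2-connected graph "minimum cut"
and "cut" coincide. This is how conditions (d) and (f) are applied. -/
theorem IsTwoConnected.isMinVertexCut_pair [Finite V] (h : IsTwoConnected G) {a b : V}
    (hcut : IsVertexCut G {a, b}) : IsMinVertexCut G {a, b} := by
  obtain ⟨hc, -, hart⟩ := isTwoConnected_iff.1 h
  refine ⟨hcut, fun B hB => (Set.ncard_insert_le a {b}).trans ?_⟩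
  rw [Set.ncard_singleton]
  by_contra! hlt
  obtain h0 | h1 : B.ncard = 0 ∨ B.ncard = 1 := by omega
  · rw [Set.ncard_eq_zero] at h0
    subst h0
    exact not_isVertexCut_empty hc hB
  · obtain ⟨v, rfl⟩ := Set.ncard_eq_one.1 h1
    exact hart v hB

end TwoConnected

/-! ### Exchange arguments on longest paths -/

section Longest

variable {G : SimpleGraph V} {u v : V}

/-- Any two vertices of `H` are joined by a path inside `H`, and `H` is a union of components of
`G - A`. -/
def IsLinkedIn (G : SimpleGraph V) (A H : Set V) : Prop :=
  IsClosedIn G A H ∧ ∀ a ∈ H, ∀ b ∈ H, ∃ K, IsPathList G K ∧ K.head? = some a ∧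
    K.getLast? = some b ∧ ∀ k ∈ K, k ∈ H

theorem exists_isPathList_of_preconnected (h : G.Preconnected) (a b : V) :
    ∃ K, IsPathList G K ∧ K.head? = some a ∧ K.getLast? = some b := by
  classical
  obtain ⟨p⟩ := h a b
  refine ⟨p.toPath.1.support, ⟨p.toPath.1.isChain_adj_support, p.toPath.2.support_nodup⟩, ?_, ?_⟩
  · rw [List.head?_eq_some_head (SimpleGraph.Walk.support_ne_nil _), SimpleGraph.Walk.head_support]
  · rw [List.getLast?_eq_some_getLast (SimpleGraph.Walk.support_ne_nil _),
      SimpleGraph.Walk.getLast_support]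

theorem IsComponentOfDel.isLinkedIn {A Q : Set V} (h : IsComponentOfDel G A Q) :
    IsLinkedIn G A Q := by
  refine ⟨h.isClosedIn, fun a ha b hb => ?_⟩
  obtain ⟨K, hK, hh, hl⟩ := exists_isPathList_of_preconnected h.preconnected ⟨a, ha⟩ ⟨b, hb⟩
  refine ⟨K.map Subtype.val, hK.map_val, ?_, ?_, fun k hk => ?_⟩
  · rw [List.head?_map, hh, Option.map_some]
  · rw [List.getLast?_map, hl, Option.map_some]
  obtain ⟨x, -, rfl⟩ := List.mem_map.1 hk
  exact x.2

theorem exists_isLinkedIn {A : Set V} {h : V} (hh : h ∉ A) : ∃ H, IsLinkedIn G A H ∧ h ∈ H := by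
  obtain ⟨Q, hQ, hhQ⟩ := exists_isComponentOfDel (G := G) hh
  exact ⟨Q, hQ.isLinkedIn, hhQ⟩

/-- The vertex `z` has a neighbour in `H`. -/
def Touches (G : SimpleGraph V) (H : Set V) (z : V) : Prop := ∃ k ∈ H, G.Adj z k

/-- The path `K` is the detour through `H` used in every exchange. The case `a = b` is allowed and
gives a path that can be hung on `a`. -/
theorem Touches.exists_bridge {A H : Set V} {a b : V} (hH : IsLinkedIn G A H)
    (ha : Touches G H a) (hb : Touches G H b) :
    ∃ K k k', IsPathList G K ∧ K.head? = some k ∧ K.getLast? = some k' ∧ (∀ x ∈ K, x ∉ A) ∧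
      G.Adj a k ∧ G.Adj b k' := by
  obtain ⟨k, hk, hak⟩ := ha
  obtain ⟨k', hk', hbk'⟩ := hb
  obtain ⟨K, hK, hh, hl, hKH⟩ := hH.2 k hk k' hk'
  exact ⟨K, k, k', hK, hh, hl, fun x hx => hH.1.1 (hKH x hx), hak, hbk'⟩

/-- A longest path among those satisfying `p`. -/
structure IsLongest (G : SimpleGraph V) (p : List V → Prop) (P : List V) : Prop where
  isPathList : IsPathList G P
  prop : p P
  length_le : ∀ l, IsPathList G l → p l → l.length ≤ P.length

theorem exists_isLongest [Finite V] {p : List V → Prop} {l : List V} (hl : IsPathList G l)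
    (hp : p l) : ∃ P, IsLongest G p P := by
  classical
  have := Fintype.ofFinite V
  let s : Set ℕ := {n | ∃ l, IsPathList G l ∧ p l ∧ l.length = n}
  have hs : BddAbove s := by
    refine ⟨Fintype.card V, ?_⟩
    rintro _ ⟨l, hl, -, rfl⟩
    exact hl.2.length_le_card
  obtain ⟨P, hP, hpP, hlen⟩ := Nat.sSup_mem (s := s) ⟨_, l, hl, hp, rfl⟩ hs
  exact ⟨P, hP, hpP, fun l' hl' hp' => hlen ▸ le_csSup hs ⟨l', hl', hp', rfl⟩⟩

/-- Every exchange below reorders the vertices of `P` together with a detour `K` into a longer path.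
As `p` is arbitrary, the exchanges serve paths with one prescribed end and with two. -/
theorem IsLongest.not_extension {p : List V → Prop} {P K l : List V} (hP : IsLongest G p P)
    (hK : IsPathList G K) (hne : K ≠ []) (hd : ∀ x ∈ K, x ∉ P) (hperm : l.Perm (P ++ K))
    (hl : l.IsChain G.Adj) : ¬ p l := by
  intro hp
  have hn : l.Nodup := hperm.nodup_iff.2
    (List.nodup_append.2 ⟨hP.isPathList.2, hK.2, by rintro a ha b hb rfl; exact hd _ hb ha⟩)
  have h1 := hP.length_le l ⟨hl, hn⟩ hp
  rw [hperm.length_eq, List.length_append] at h1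
  have := List.length_pos_iff.2 hne
  omega

variable {H : Set V} {U A B : List V} {s s₁ s₂ a a' b b' c t : V}

theorem IsLongest.not_touches_getLast {P : List V} (hP : IsLongest G (·.head? = some u) P)
    (hH : IsLinkedIn G {x | x ∈ P} H) (ht : P.getLast? = some t) : ¬ Touches G H t := by
  intro h
  obtain ⟨K, k, k', hK, hh, hl, hKP, htk, -⟩ := h.exists_bridge hH h
  refine hP.not_extension hK (by rintro rfl; simp at hh) hKP (List.Perm.refl _) ?_ ?_
  · simp only [List.isChain_append, hh, ht]
    exact ⟨hP.isPathList.1, hK.1, by simpa using htk⟩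
  · simp [List.head?_append, hP.prop]

theorem IsLongest.not_touches_consecutive {P : List V} {p : List V → Prop} (hP : IsLongest G p P)
    (hH : IsLinkedIn G {x | x ∈ P} H) (hPe : P = A ++ B) (hp : ∀ K : List V, p (A ++ (K ++ B)))
    (hla : A.getLast? = some a) (hlb : B.head? = some b) (ha : Touches G H a) :
    ¬ Touches G H b := by
  intro hb
  obtain ⟨K, k, k', hK, hh, hl, hKP, hak, hbk⟩ := ha.exists_bridge hH hb
  have hc := hP.isPathList.1
  have hKc := hK.1
  subst hPe
  refine hP.not_extension (l := A ++ (K ++ B)) hK (by rintro rfl; simp at hh) hKP ?_ ?_ (hp K)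
  · classical
    simp [List.perm_iff_count, List.count_append]
    intros; omega
  · simp only [List.isChain_append] at hc ⊢
    simp_all [hbk.symm]

/-- An edge `a b` would give the longer path `U s₁ K s₂ Aʳ B`, with `ʳ` for reversal. -/
theorem IsLongest.not_adj_successors {P : List V} {p : List V → Prop} (hP : IsLongest G p P)
    (hH : IsLinkedIn G {x | x ∈ P} H) (hPe : P = U ++ s₁ :: (A ++ s₂ :: B))
    (hp : ∀ K : List V, p (U ++ s₁ :: (K ++ s₂ :: (A.reverse ++ B))))
    (h₁ : Touches G H s₁) (h₂ : Touches G H s₂) (ha : A.head? = some a) (hb : B.head? = some b) :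
    ¬ G.Adj a b := by
  intro hab
  obtain ⟨K, k, k', hK, hh, hl, hKP, hak, hbk⟩ := h₁.exists_bridge hH h₂
  have hc := hP.isPathList.1
  have hKc := hK.1
  subst hPe
  refine hP.not_extension (l := U ++ s₁ :: (K ++ s₂ :: (A.reverse ++ B))) hK
    (by rintro rfl; simp at hh) hKP ?_ ?_ (hp K)
  · classical
    simp [List.perm_iff_count, List.count_append, List.count_cons]
    intros; omega
  · simp only [List.isChain_append, List.isChain_cons] at hc ⊢
    simp_all [hbk.symm, isChain_reverse_adj]
    obtain ⟨z, hz⟩ : ∃ z, A.getLast? = some z := by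
      cases A with
      | nil => simp at ha
      | cons x A => exact ⟨_, List.getLast?_cons⟩
    rw [hz, Option.getD_some]
    exact (hc.2.1.2.2.2 z hz).symm

/-- An edge `c t` would give `U Bʳ s K`, which now ends inside `H`. -/
theorem IsLongest.not_adj_last_pred {P : List V} {p : List V → Prop} (hP : IsLongest G p P)
    (hH : IsLinkedIn G {x | x ∈ P} H) (hPe : P = U ++ s :: B)
    (hp : ∀ K : List V, p (U ++ (B.reverse ++ s :: K)))
    (hs : Touches G H s) (hc : U.getLast? = some c) (ht : B.getLast? = some t) :
    ¬ G.Adj c t := by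
  intro hct
  obtain ⟨K, k, k', hK, hh, hl, hKP, hsk, -⟩ := hs.exists_bridge hH hs
  have hch := hP.isPathList.1
  have hKc := hK.1
  subst hPe
  refine hP.not_extension (l := U ++ (B.reverse ++ s :: K)) hK
    (by rintro rfl; simp at hh) hKP ?_ ?_ (hp K)
  · classical
    simp [List.perm_iff_count, List.count_append, List.count_cons]
    intros; omega
  · simp only [List.isChain_append, List.isChain_cons] at hch ⊢
    simp_all [isChain_reverse_adj]
    exact fun x hx => (hch.2.1.1 x hx).symm

/-- An edge `a t` would give `U s₁ K s₂ Aʳ Bʳ`. -/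
theorem IsLongest.not_adj_succ_last {P : List V} {p : List V → Prop} (hP : IsLongest G p P)
    (hH : IsLinkedIn G {x | x ∈ P} H) (hPe : P = U ++ s₁ :: (A ++ s₂ :: B))
    (hp : ∀ K : List V, p (U ++ s₁ :: (K ++ s₂ :: (A.reverse ++ B.reverse))))
    (h₁ : Touches G H s₁) (h₂ : Touches G H s₂) (ha : A.head? = some a)
    (ht : B.getLast? = some t) : ¬ G.Adj a t := by
  intro hat
  obtain ⟨K, k, k', hK, hh, hl, hKP, hak, hbk⟩ := h₁.exists_bridge hH h₂
  have hc := hP.isPathList.1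
  have hKc := hK.1
  subst hPe
  refine hP.not_extension (l := U ++ s₁ :: (K ++ s₂ :: (A.reverse ++ B.reverse))) hK
    (by rintro rfl; simp at hh) hKP ?_ ?_ (hp K)
  · classical
    simp [List.perm_iff_count, List.count_append, List.count_cons]
    intros; omega
  · simp only [List.isChain_append, List.isChain_cons] at hc ⊢
    simp_all [hbk.symm, isChain_reverse_adj]
    obtain ⟨z, hz⟩ : ∃ z, A.getLast? = some z := by
      cases A with
      | nil => simp at ha
      | cons x A => exact ⟨_, List.getLast?_cons⟩
    rw [hz, Option.getD_some]
    exact (hc.2.1.2.2.2 z hz).symm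

/-- An edge `c a` would give `U Aʳ s₁ K s₂ B`. -/
theorem IsLongest.not_adj_predecessors {P : List V} {p : List V → Prop} (hP : IsLongest G p P)
    (hH : IsLinkedIn G {x | x ∈ P} H) (hPe : P = U ++ s₁ :: (A ++ s₂ :: B))
    (hp : ∀ K : List V, p (U ++ (A.reverse ++ s₁ :: (K ++ s₂ :: B))))
    (h₁ : Touches G H s₁) (h₂ : Touches G H s₂) (hc : U.getLast? = some c)
    (ha : A.getLast? = some a) : ¬ G.Adj c a := by
  intro hca
  obtain ⟨K, k, k', hK, hh, hl, hKP, hak, hbk⟩ := h₁.exists_bridge hH h₂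
  have hch := hP.isPathList.1
  have hKc := hK.1
  subst hPe
  refine hP.not_extension (l := U ++ (A.reverse ++ s₁ :: (K ++ s₂ :: B))) hK
    (by rintro rfl; simp at hh) hKP ?_ ?_ (hp K)
  · classical
    simp [List.perm_iff_count, List.count_append, List.count_cons]
    intros; omega
  · simp only [List.isChain_append, List.isChain_cons] at hch ⊢
    simp_all [hbk.symm, isChain_reverse_adj]
    intro x hx
    have := hch.2.1.1
    rw [hx] at this
    exact this.symm

/-- Both edges together would give `U A Bʳ s₂ K s₁`: the vertex `s₁` is bypassed and becomes the
end. -/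
theorem IsLongest.not_adj_and_adj {P : List V} {p : List V → Prop} (hP : IsLongest G p P)
    (hH : IsLinkedIn G {x | x ∈ P} H) (hPe : P = U ++ s₁ :: (A ++ s₂ :: B))
    (hp : ∀ K : List V, p (U ++ (A ++ (B.reverse ++ s₂ :: (K ++ [s₁])))))
    (h₁ : Touches G H s₁) (h₂ : Touches G H s₂) (hc : U.getLast? = some c)
    (ha : A.head? = some a) (ha' : A.getLast? = some a') (ht : B.getLast? = some t) :
    ¬ (G.Adj c a ∧ G.Adj a' t) := by
  rintro ⟨hca, hat⟩
  obtain ⟨K, k, k', hK, hh, hl, hKP, hak, hbk⟩ := h₂.exists_bridge hH h₁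
  have hch := hP.isPathList.1
  have hKc := hK.1
  subst hPe
  refine hP.not_extension (l := U ++ (A ++ (B.reverse ++ s₂ :: (K ++ [s₁])))) hK
    (by rintro rfl; simp at hh) hKP ?_ ?_ (hp K)
  · classical
    simp [List.perm_iff_count, List.count_append, List.count_cons]
    intros; omega
  · simp only [List.isChain_append, List.isChain_cons] at hch ⊢
    simp_all [hbk.symm, isChain_reverse_adj]
    exact fun x hx => (hch.2.1.2.2.1.1 x hx).symm

end Longest

/-! ### Attachments of a component off a longest path in a `4K₁`-free graph -/

section Independence

variable {G : SimpleGraph V} {u v : V}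

/-- `G` has no three pairwise non-adjacent vertices. -/
def NoIndependentTriple (G : SimpleGraph V) : Prop :=
  ∀ a b c, a ≠ b → a ≠ c → b ≠ c → G.Adj a b ∨ G.Adj a c ∨ G.Adj b c

/-- `G` has no four pairwise non-adjacent vertices. -/
def NoIndependentQuadruple (G : SimpleGraph V) : Prop :=
  ∀ a b c d, a ≠ b → a ≠ c → a ≠ d → b ≠ c → b ≠ d → c ≠ d →
    G.Adj a b ∨ G.Adj a c ∨ G.Adj a d ∨ G.Adj b c ∨ G.Adj b d ∨ G.Adj c d

theorem IsKK1Free.noIndependentQuadruple (h : IsKK1Free 4 G) : NoIndependentQuadruple G := by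
  intro a b c d hab hac had hbc hbd hcd
  by_contra! hcon
  refine h ⟨⟨⟨![a, b, c, d], ?_⟩, ?_⟩⟩
  · intro i j hij
    fin_cases i <;> fin_cases j <;> simp_all
  · intro i j
    change G.Adj (![a, b, c, d] i) (![a, b, c, d] j) ↔ False
    fin_cases i <;> fin_cases j <;> simp_all [G.adj_comm]

theorem exists_head?_eq_some {l : List V} (h : l ≠ []) : ∃ a, l.head? = some a :=
  ⟨_, List.head?_eq_some_head h⟩

theorem exists_getLast?_eq_some {l : List V} (h : l ≠ []) : ∃ a, l.getLast? = some a :=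
  ⟨_, List.getLast?_eq_some_getLast h⟩

theorem not_adj_of_not_touches {H : Set V} {h z : V} (hh : h ∈ H) (hz : ¬ Touches G H z) :
    ¬ G.Adj h z := fun hadj => hz ⟨h, hh, hadj.symm⟩

/-- On a longest path from `u`, of two vertices with neighbours in a component off the path
the first one is `u`; their successors have no neighbours in the component and are not adjacent. -/
theorem IsLongest.eq_nil_of_touches {H : Set V} {P U A B : List V} {s₁ s₂ : V}
    (hG : NoIndependentQuadruple G) (hP : IsLongest G (·.head? = some u) P)
    (hH : IsLinkedIn G {x | x ∈ P} H) (hPe : P = U ++ s₁ :: (A ++ s₂ :: B))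
    (h₁ : Touches G H s₁) (h₂ : Touches G H s₂) :
    U = [] ∧ ∃ a b, a ∈ A ∧ b ∈ B ∧ ¬ Touches G H a ∧
      ¬ Touches G H b ∧ ¬ G.Adj a b := by
  have hhead := hP.prop
  simp only [hPe, List.head?_append, List.head?_cons] at hhead
  have hB : B ≠ [] := by
    rintro rfl
    exact hP.not_touches_getLast hH (t := s₂) (by simp [hPe, List.getLast?_cons]) h₂
  have hA : A ≠ [] := by
    rintro rfl
    exact hP.not_touches_consecutive hH (A := U ++ [s₁]) (B := s₂ :: B) (a := s₁) (b := s₂)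
      (by simp [hPe]) (by simpa using hhead) (by simp) (by simp) h₁ h₂
  obtain ⟨a, ha⟩ := exists_head?_eq_some hA
  obtain ⟨a', ha'⟩ := exists_getLast?_eq_some hA
  obtain ⟨b, hb⟩ := exists_head?_eq_some hB
  obtain ⟨t, ht⟩ := exists_getLast?_eq_some hB
  have hat : ¬ Touches G H a := hP.not_touches_consecutive hH (A := U ++ [s₁])
    (B := A ++ s₂ :: B) (a := s₁) (by simp [hPe]) (by simpa using hhead) (by simp)
    (by simp [ha]) h₁
  have hbt : ¬ Touches G H b := hP.not_touches_consecutive hH (A := U ++ s₁ :: (A ++ [s₂]))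
    (B := B) (a := s₂) (by simp [hPe]) (by simpa using hhead) (by simp [List.getLast?_cons])
    hb h₂
  refine ⟨?_, a, b, List.mem_of_head? ha, List.mem_of_head? hb, hat, hbt,
    hP.not_adj_successors hH hPe (by simpa using hhead) h₁ h₂ ha hb⟩
  by_contra hU
  obtain ⟨c, hc⟩ := exists_getLast?_eq_some hU
  have hU' : U.head? = some u := by
    obtain ⟨c', hc'⟩ := exists_head?_eq_some hU
    simpa [hc'] using hhead
  have hct : ¬ Touches G H c := fun h => hP.not_touches_consecutive hH (A := U)
    (B := s₁ :: (A ++ s₂ :: B)) (b := s₁) (by simp [hPe]) (by simp [hU']) hc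
    (by simp) h h₁
  have ha't : ¬ Touches G H a' := fun h => hP.not_touches_consecutive hH (A := U ++ s₁ :: A)
    (B := s₂ :: B) (b := s₂) (by simp [hPe]) (by simp [hU']) (by simp [List.getLast?_cons, ha'])
    (by simp) h h₂
  have htt : ¬ Touches G H t := hP.not_touches_getLast hH (by simp [hPe, List.getLast?_cons, ht])
  have hn := hP.isPathList.2
  have hcU := List.mem_of_getLast? hc
  have haA := List.mem_of_head? ha
  have haA' := List.mem_of_getLast? ha'
  have htB := List.mem_of_getLast? ht
  obtain ⟨h, hh⟩ : H.Nonempty := h₁.imp fun _ hk => hk.1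
  have hhP : h ∉ P := hH.1.1 hh
  subst hPe
  have hct' : ¬ G.Adj c t := hP.not_adj_last_pred hH (s := s₁) (B := A ++ s₂ :: B) rfl
    (by simp [hU']) h₁ hc (by simp [List.getLast?_cons, ht])
  have hat' : ¬ G.Adj a t := hP.not_adj_succ_last hH rfl (by simp [hU']) h₁ h₂
    ha ht
  have hca' : ¬ G.Adj c a' := hP.not_adj_predecessors hH rfl (by simp [hU'])
    h₁ h₂ hc ha'
  have hx := hP.not_adj_and_adj hH rfl (by simp [hU']) h₁ h₂ hc ha ha' ht
  have e1 := not_adj_of_not_touches hh hct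
  have e2 := not_adj_of_not_touches hh hat
  have e3 := not_adj_of_not_touches hh ha't
  have e4 := not_adj_of_not_touches hh htt
  simp only [List.nodup_append, List.nodup_cons, List.mem_append, List.mem_cons] at hn
  simp only [List.mem_append, List.mem_cons, not_or] at hhP
  have n1 : c ≠ a := hn.2.2 c hcU a (by simp [haA])
  have n2 : c ≠ a' := hn.2.2 c hcU a' (by simp [haA'])
  have n3 : c ≠ t := hn.2.2 c hcU t (by simp [htB])
  have n4 : a ≠ t := hn.2.1.2.2.2 a haA t (by simp [htB])
  have n5 : a' ≠ t := hn.2.1.2.2.2 a' haA' t (by simp [htB])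
  have m1 : h ≠ c := by rintro rfl; exact hhP.1 hcU
  have m2 : h ≠ a := by rintro rfl; exact hhP.2.2.1 haA
  have m3 : h ≠ a' := by rintro rfl; exact hhP.2.2.1 haA'
  have m4 : h ≠ t := by rintro rfl; exact hhP.2.2.2.2 htB
  -- The known non-adjacencies leave only the edge `c a` in the first quadruple and `a' t` in the
  -- second, and `hx` forbids having both.
  have q1 := hG h c a t m1 m2 m4 n1 n3 n4
  have q2 := hG h c a' t m1 m3 m4 n2 n3 n5
  tauto

end Independence

/-! ### Hamiltonian paths when the independence number is at most two -/

section SmallIndependence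

variable {G : SimpleGraph V} {u v : V} {H : Set V}

/-- Only the attachments of `H` matter: deleting these few vertices instead of all of `A` already
cuts `H` off. -/
theorem IsClosedIn.of_touches {A S : Set V} (hH : IsClosedIn G A H) (hS : S ⊆ A)
    (h : ∀ z ∈ A, Touches G H z → z ∈ S) : IsClosedIn G S H := by
  refine ⟨fun x hx hxS => hH.1 hx (hS hxS), fun v hv w hvw hw => ?_⟩
  by_contra hwH
  have hwA : w ∈ A := by
    by_contra hwA
    exact hwH (hH.2 v hv w hvw hwA)
  exact hw (h w hwA ⟨v, hv, hvw.symm⟩)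

theorem exists_touches_of_preconnected (hc : G.Preconnected) {A : Set V} {h z : V}
    (hH : IsClosedIn G A H) (hh : h ∈ H) (hz : z ∈ A) : ∃ s ∈ A, Touches G H s := by
  by_contra! hcon
  exact not_isVertexCut_empty hc (isVertexCut_of_isClosedIn (u := h) (v := z)
    (hH.of_touches (Set.empty_subset A) fun s hs hsH => absurd hsH (hcon s hs)) hh (by simp)
    fun hzH => hH.1 hzH hz)

theorem exists_split_pair {P : List V} {s s' : V} (hs : s ∈ P) (hs' : s' ∈ P) (hne : s ≠ s') :
    ∃ U A B, P = U ++ s :: (A ++ s' :: B) ∨ P = U ++ s' :: (A ++ s :: B) := by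
  obtain ⟨U, B, rfl⟩ := List.append_of_mem hs
  rcases List.mem_append.1 hs' with h | h
  · obtain ⟨U₁, U₂, rfl⟩ := List.append_of_mem h
    exact ⟨U₁, U₂, B, .inr (by simp)⟩
  · rcases List.mem_cons.1 h with h | h
    · exact absurd h.symm hne
    · obtain ⟨B₁, B₂, rfl⟩ := List.append_of_mem h
      exact ⟨U, B₁, B₂, .inl (by simp)⟩

theorem IsLongest.reverse {p : List V → Prop} {P : List V} (hP : IsLongest G p P) :
    IsLongest G (fun l => p l.reverse) P.reverse where
  isPathList := hP.isPathList.reverse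
  prop := by simpa using hP.prop
  length_le l hl hp := by simpa using hP.length_le l.reverse hl.reverse hp

/-- The successors of two attachments, with a vertex of `H`, form an independent triple. The
exchanges used preserve both ends of the path, so this also applies when both are prescribed. -/
theorem IsLongest.false_of_touches {p : List V → Prop} {P U A B : List V} {s₁ s₂ : V}
    (hG : NoIndependentTriple G) (hP : IsLongest G p P)
    (hp : ∀ l : List V, l.head? = P.head? → l.getLast? = P.getLast? → p l)
    (hH : IsLinkedIn G {x | x ∈ P} H) (hPe : P = U ++ s₁ :: (A ++ s₂ :: B))
    (h₁ : Touches G H s₁) (h₂ : Touches G H s₂) (hB : B ≠ []) : False := by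
  have hA : A ≠ [] := by
    rintro rfl
    exact hP.not_touches_consecutive hH (A := U ++ [s₁]) (B := s₂ :: B) (a := s₁) (b := s₂)
      (by simp [hPe]) (fun K => hp _ (by simp [hPe])
        (by simp [hPe, List.getLast?_append, List.getLast?_cons])) (by simp) (by simp) h₁ h₂
  obtain ⟨a, ha⟩ := exists_head?_eq_some hA
  obtain ⟨b, hb⟩ := exists_head?_eq_some hB
  obtain ⟨t, ht⟩ := exists_getLast?_eq_some hB
  have hat : ¬ Touches G H a := hP.not_touches_consecutive hH (A := U ++ [s₁])
    (B := A ++ s₂ :: B) (a := s₁) (by simp [hPe]) (fun K => hp _ (by simp [hPe])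
        (by simp [hPe, List.getLast?_append, List.getLast?_cons])) (by simp)
    (by simp [ha]) h₁
  have hbt : ¬ Touches G H b := hP.not_touches_consecutive hH (A := U ++ s₁ :: (A ++ [s₂]))
    (B := B) (a := s₂) (by simp [hPe]) (fun K => hp _ (by simp [hPe])
        (by simp [hPe, List.getLast?_append, List.getLast?_cons, ht]))
    (by simp [List.getLast?_cons]) hb h₂
  have hab := hP.not_adj_successors hH hPe (fun K => hp _ (by simp [hPe])
    (by simp [hPe, List.getLast?_append, List.getLast?_cons, ht])) h₁ h₂ ha hb
  obtain ⟨h, hh⟩ : H.Nonempty := h₁.imp fun _ hk => hk.1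
  have hhP : h ∉ P := hH.1.1 hh
  have haA := List.mem_of_head? ha
  have hbB := List.mem_of_head? hb
  have hn := hP.isPathList.2
  subst hPe
  simp only [List.nodup_append, List.nodup_cons, List.mem_append, List.mem_cons] at hn
  simp only [List.mem_append, List.mem_cons, not_or] at hhP
  have n1 : a ≠ b := hn.2.1.2.2.2 a haA b (by simp [hbB])
  have m1 : h ≠ a := by rintro rfl; exact hhP.2.2.1 haA
  have m2 : h ≠ b := by rintro rfl; exact hhP.2.2.2.2 hbB
  have e1 := not_adj_of_not_touches hh hat
  have e2 := not_adj_of_not_touches hh hbt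
  have := hG h a b m1 m2 n1
  tauto

/-- A connected graph with independence number at most two has a Hamiltonian path from every
vertex that is not an articulation point. -/
theorem exists_isPathList_from [Finite V] (hG : NoIndependentTriple G) (hc : G.Preconnected)
    (hu : ¬ IsArticulationPoint G u) : ∃ l, IsPathList G l ∧ l.head? = some u ∧ ∀ v, v ∈ l := by
  obtain ⟨P, hP⟩ := exists_isLongest (G := G) (p := (·.head? = some u)) (l := [u])
    ⟨by simp, by simp⟩ rfl
  refine ⟨P, hP.isPathList, hP.prop, ?_⟩
  by_contra! hcon
  obtain ⟨h, hhP⟩ := hcon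
  obtain ⟨H, hH, hh⟩ := exists_isLinkedIn (G := G) (A := {x | x ∈ P}) hhP
  have huP : u ∈ P := List.mem_of_head? hP.prop
  obtain ⟨s, hsP, hs⟩ := exists_touches_of_preconnected hc hH.1 hh (show u ∈ {x | x ∈ P} from huP)
  have hends : ∀ l : List V, l.head? = P.head? → l.getLast? = P.getLast? → l.head? = some u :=
    fun l hl _ => hl.trans hP.prop
  have huniq : ∀ z ∈ {x | x ∈ P}, Touches G H z → z ∈ ({s} : Set V) := by
    intro z hzP hz
    by_contra hzs
    obtain ⟨U, A, B, hPe | hPe⟩ := exists_split_pair hzP hsP hzs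
    · refine hP.false_of_touches hG hends hH hPe hz hs ?_
      rintro rfl
      exact hP.not_touches_getLast hH (t := s) (by simp [hPe, List.getLast?_cons]) hs
    · refine hP.false_of_touches hG hends hH hPe hs hz ?_
      rintro rfl
      exact hP.not_touches_getLast hH (t := z) (by simp [hPe, List.getLast?_cons]) hz
  obtain ⟨U, B, hPe⟩ := List.append_of_mem hsP
  have hB : B ≠ [] := by
    rintro rfl
    exact hP.not_touches_getLast hH (t := s) (by simp [hPe, List.getLast?_cons]) hs
  obtain ⟨t, ht⟩ := exists_getLast?_eq_some hB
  have htB := List.mem_of_getLast? ht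
  have hn := hP.isPathList.2
  rw [hPe] at hn
  simp only [List.nodup_append, List.nodup_cons, List.mem_cons] at hn
  have hts : t ≠ s := by rintro rfl; exact hn.2.1.1 htB
  have htP : t ∈ P := by simp [hPe, htB]
  have htH : t ∉ H := fun h => hH.1.1 h htP
  -- If the only attachment `s` were `u`, then `u` would separate `H` from `t`.
  have hU : U ≠ [] := by
    rintro rfl
    have hsu : s = u := by simpa [hPe] using hP.prop
    subst hsu
    exact hu (isVertexCut_of_isClosedIn (hH.1.of_touches (by simpa using hsP) huniq) hh
      (by simpa using hts) htH)
  obtain ⟨c, hcU⟩ := exists_getLast?_eq_some hU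
  have hcU' := List.mem_of_getLast? hcU
  have hcP : c ∈ P := by simp [hPe, hcU']
  have hcs : c ≠ s := hn.2.2 c hcU' s (by simp)
  have hct : c ≠ t := hn.2.2 c hcU' t (by simp [htB])
  have hUu : U.head? = some u := by
    obtain ⟨c', hc'⟩ := exists_head?_eq_some hU
    simpa [hPe, hc'] using hP.prop
  have e1 := not_adj_of_not_touches hh fun hz => hcs (huniq c hcP hz)
  have e2 := not_adj_of_not_touches hh fun hz => hts (huniq t htP hz)
  -- The predecessor `c` of the only attachment, the end `t` and `h` are pairwise non-adjacent.
  have e3 := hP.not_adj_last_pred hH hPe (by simp [hUu]) hs hcU ht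
  have := hG h c t (by rintro rfl; exact hhP hcP) (by rintro rfl; exact hhP htP) hct
  tauto

/-- In a connected graph with independence number at most two and without articulation points,
two vertices that do not form a vertex cut are the ends of a Hamiltonian path. -/
theorem exists_isPathList_between [Finite V] (hG : NoIndependentTriple G) (hc : G.Preconnected)
    (hart : ∀ y, ¬ IsArticulationPoint G y) (huv : u ≠ v) (hcut : ¬ IsVertexCut G {u, v}) :
    ∃ l, IsPathList G l ∧ l.head? = some u ∧ l.getLast? = some v ∧ ∀ w, w ∈ l := by
  obtain ⟨l, hl, hlu, hlv⟩ := exists_isPathList_of_preconnected hc u v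
  obtain ⟨P, hP⟩ := exists_isLongest (p := fun l => l.head? = some u ∧ l.getLast? = some v)
    hl ⟨hlu, hlv⟩
  refine ⟨P, hP.isPathList, hP.prop.1, hP.prop.2, ?_⟩
  by_contra! hcon
  obtain ⟨h, hhP⟩ := hcon
  obtain ⟨H, hH, hh⟩ := exists_isLinkedIn (G := G) (A := {x | x ∈ P}) hhP
  have huP : u ∈ P := List.mem_of_head? hP.prop.1
  have hvP : v ∈ P := List.mem_of_getLast? hP.prop.2
  have hends : ∀ l : List V, l.head? = P.head? → l.getLast? = P.getLast? →
      l.head? = some u ∧ l.getLast? = some v :=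
    fun l h1 h2 => ⟨h1.trans hP.prop.1, h2.trans hP.prop.2⟩
  have hPH : ∀ z ∈ P, z ∉ H := fun z hz hzH => hH.1.1 hzH hz
  have hother : ∀ s ∈ P, ∃ s' ∈ P, Touches G H s' ∧ s' ≠ s := by
    intro s hs
    by_contra! hs'
    obtain ⟨z, hz, hzs⟩ : ∃ z ∈ P, z ≠ s := by
      by_cases hsu : u = s
      · exact ⟨v, hvP, by rintro rfl; exact huv hsu⟩
      · exact ⟨u, huP, hsu⟩
    exact hart s (isVertexCut_of_isClosedIn (hH.1.of_touches (by simpa using hs) hs') hh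
      (by simpa using hzs) (hPH z hz))
  -- Two attachments must be the two ends: a vertex after the second gives a contradiction, and a
  -- vertex before the first does so after reversing the path.
  have hpair : ∀ U A B s₁ s₂, P = U ++ s₁ :: (A ++ s₂ :: B) → Touches G H s₁ → Touches G H s₂ →
      U = [] ∧ B = [] := by
    intro U A B s₁ s₂ hPe h₁ h₂
    constructor
    · by_contra hU
      refine hP.reverse.false_of_touches (U := B.reverse) (A := A.reverse) (B := U.reverse) hG
        ?_ (by simpa using hH) (by simp [hPe]) h₂ h₁ (by simpa using hU)
      intro l h1 h2
      exact hends _ (by simpa using h2) (by simpa using h1)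
    · by_contra hB
      exact hP.false_of_touches hG hends hH hPe h₁ h₂ hB
  obtain ⟨s₁, hs₁P, hs₁, -⟩ := hother u huP
  obtain ⟨s₂, hs₂P, hs₂, hne⟩ := hother s₁ hs₁P
  obtain ⟨U, A, B, s₁, s₂, hPe, hs₁, hs₂⟩ : ∃ U A B s₁ s₂, P = U ++ s₁ :: (A ++ s₂ :: B) ∧
      Touches G H s₁ ∧ Touches G H s₂ := by
    obtain ⟨U, A, B, hPe | hPe⟩ := exists_split_pair hs₁P hs₂P hne.symm
    · exact ⟨U, A, B, s₁, s₂, hPe, hs₁, hs₂⟩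
    · exact ⟨U, A, B, s₂, s₁, hPe, hs₂, hs₁⟩
  obtain ⟨rfl, rfl⟩ := hpair _ _ _ _ _ hPe hs₁ hs₂
  obtain rfl : s₁ = u := by simpa [hPe] using hP.prop.1
  obtain rfl : s₂ = v := by simpa [hPe, List.getLast?_cons] using hP.prop.2
  have hA : A ≠ [] := by
    rintro rfl
    exact hP.not_touches_consecutive hH (A := [s₁]) (B := [s₂]) (a := s₁) (b := s₂)
      (by simp [hPe]) (fun K => by simp [List.getLast?_cons]) (by simp) (by simp) hs₁ hs₂
  obtain ⟨a, ha⟩ := exists_head?_eq_some hA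
  have haA := List.mem_of_head? ha
  have hn := hP.isPathList.2
  rw [hPe] at hn
  simp only [List.nodup_append, List.nodup_cons, List.mem_append, List.mem_cons] at hn
  refine hcut (isVertexCut_of_isClosedIn (v := a) (hH.1.of_touches (S := {s₁, s₂}) ?_ ?_) hh ?_
    (hPH a (by simp [hPe, haA])))
  · rintro z (rfl | rfl)
    exacts [huP, hvP]
  · intro z hzP hz
    by_contra hzs
    simp only [Set.mem_insert_iff, Set.mem_singleton_iff, not_or] at hzs
    have hzA : z ∈ A := by
      have : z ∈ P := hzP
      simpa [hPe, hzs] using this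
    obtain ⟨A₁, A₂, rfl⟩ := List.append_of_mem hzA
    have := (hpair [] A₁ (A₂ ++ [s₂]) s₁ z (by simp [hPe]) hs₁ hz).2
    simp at this
  · simp only [Set.mem_insert_iff, Set.mem_singleton_iff]
    rintro (rfl | rfl)
    · exact hn.2.1.1 (.inl haA)
    · exact hn.2.1.2.2.2 _ haA _ (.inl rfl) rfl

/-- A clique can be traversed in any order, so only the ends need care: they may coincide only if
the clique is a single vertex. -/
theorem exists_isChain_of_clique {B : List V} (hn : B.Nodup)
    (hB : ∀ x ∈ B, ∀ y ∈ B, x ≠ y → G.Adj x y) {m v : V} (hm : m ∈ B) (hv : v ∈ B)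
    (hmv : m ≠ v ∨ B = [v]) :
    ∃ M : List V, M.Perm B ∧ M.head? = some m ∧ M.getLast? = some v ∧ M.IsChain G.Adj := by
  classical
  rcases hmv with hmv | rfl
  · have hp : B.Perm (m :: ((B.erase m).erase v ++ [v])) := by
      refine (List.perm_cons_erase hm).trans (List.Perm.cons _ ?_)
      refine (List.perm_cons_erase ((List.mem_erase_of_ne hmv.symm).2 hv)).trans ?_
      exact List.perm_append_comm (l₁ := [v])
    refine ⟨_, hp.symm, rfl, by simp [List.getLast?_cons], List.Pairwise.isChain ?_⟩
    have hn' := (hp.nodup_iff).1 hn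
    exact List.Pairwise.imp_of_mem (fun {a b} ha hb hab => hB a (hp.mem_iff.2 ha) b
      (hp.mem_iff.2 hb) hab) hn'
  · obtain rfl : m = v := by simpa using hm
    exact ⟨[m], List.Perm.refl _, rfl, rfl, by simp⟩

theorem IsVertexCut.exists_inDifferentComponents {A : Set V} (h : IsVertexCut G A) (hu : u ∉ A) :
    ∃ v, InDifferentComponents G A u v := by
  obtain ⟨p, q, hpq⟩ := isVertexCut_iff.1 h
  obtain ⟨hp, hq, X, hX, hpX, hqX⟩ := inDifferentComponents_iff.1 hpq
  by_cases huX : u ∈ X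
  · exact ⟨q, inDifferentComponents_iff.2 ⟨hu, hq, X, hX, huX, hqX⟩⟩
  · exact ⟨p, (inDifferentComponents_iff.2 ⟨hp, hu, X, hX, hpX, huX⟩).symm⟩

/-- A Hamiltonian path `U y B` from `u` has `u` separated by `y` from all of `B`, so `B` is a
clique. It can be reordered to begin at a neighbour of `y` and end in `N`. -/
theorem exists_clique_end {y : V} {N : Set V} (hG : NoIndependentTriple G)
    (hy : IsArticulationPoint G y)
    (hN : ∀ y, y ≠ u → IsArticulationPoint G y → ∃ v ∈ N, InDifferentComponents G {y} u v)
    (hyu : y ≠ u) {l : List V} (hl : IsPathList G l) (hlu : l.head? = some u)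
    (hall : ∀ v, v ∈ l) :
    ∃ l, IsPathList G l ∧ l.head? = some u ∧ (∀ w, w ∈ l) ∧ ∃ v ∈ N, l.getLast? = some v := by
  obtain ⟨U, B, rfl⟩ := List.append_of_mem (hall y)
  have hU : U ≠ [] := by
    rintro rfl
    exact hyu (by simpa using hlu)
  have hUu : U.head? = some u := by
    obtain ⟨c', hc'⟩ := exists_head?_eq_some hU
    simpa [hc'] using hlu
  have huU := List.mem_of_head? hUu
  have hch := hl.1
  have hn := hl.2
  rw [List.isChain_append, List.isChain_cons] at hch
  have hn' := hn
  simp only [List.nodup_append, List.nodup_cons, List.mem_cons] at hn'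
  have hUy : ∀ x ∈ U, x ∉ ({y} : Set V) := fun x hx => hn'.2.2 x hx y (by simp)
  have hBy : ∀ x ∈ B, x ∉ ({y} : Set V) := by
    rintro x hx rfl
    exact hn'.2.1.1 hx
  have hmem : ∀ x, x ∉ ({y} : Set V) → x ∈ U ∨ x ∈ B := by
    intro x hx
    have := hall x
    simp only [List.mem_append, List.mem_cons, Set.mem_singleton_iff] at this hx
    tauto
  have hdiffB : ∀ v, InDifferentComponents G {y} u v → v ∈ B := by
    intro v hv
    obtain ⟨-, hvy, X, hX, huX, hvX⟩ := inDifferentComponents_iff.1 hv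
    exact (hmem v hvy).resolve_left fun hvU => hvX (hX.mem_of_isChain hch.1 hUy huU huX hvU)
  obtain ⟨v₀, hv₀⟩ := hy.exists_inDifferentComponents (hUy u huU)
  have hv₀B := hdiffB v₀ hv₀
  obtain ⟨-, -, X, hX, huX, hv₀X⟩ := inDifferentComponents_iff.1 hv₀
  have hBX : ∀ w ∈ B, w ∉ X := fun w hw hwX =>
    hv₀X (hX.mem_of_isChain hch.2.1.2 hBy hw hwX hv₀B)
  have hUX : ∀ w ∈ U, w ∈ X := fun w hw => hX.mem_of_isChain hch.1 hUy huU huX hw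
  have hUB : ∀ x ∈ U, ∀ w ∈ B, ¬ G.Adj x w := fun x hx w hw hxw =>
    hBX w hw (hX.2 x (hUX x hx) w hxw (hBy w hw))
  have hclique : ∀ x ∈ B, ∀ w ∈ B, x ≠ w → G.Adj x w := by
    intro x hx w hw hxw
    have h1 := hG u x w (by rintro rfl; exact hBX _ hx huX) (by rintro rfl; exact hBX _ hw huX) hxw
    have h2 := hUB u huU x hx
    have h3 := hUB u huU w hw
    tauto
  obtain ⟨v, hvN, hvB, m, hmB, hym, hmv⟩ :
      ∃ v ∈ N, v ∈ B ∧ ∃ m ∈ B, G.Adj y m ∧ (m ≠ v ∨ B = [v]) := by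
    obtain ⟨v, hvN, hv⟩ := hN y hyu hy
    have hvB := hdiffB v hv
    cases B with
    | nil => simp at hvB
    | cons b B =>
      have hyb : G.Adj y b := hch.2.1.1 b rfl
      by_cases hbv : b = v
      · subst hbv
        by_cases hBnil : B = []
        · exact ⟨b, hvN, hvB, b, by simp, hyb, .inr (by rw [hBnil])⟩
        by_cases hm : ∃ m ∈ B, G.Adj y m
        · obtain ⟨m, hm, hym⟩ := hm
          refine ⟨b, hvN, hvB, m, by simp [hm], hym, .inl ?_⟩
          rintro rfl
          exact (List.nodup_cons.1 hn'.2.1.2).1 hm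
        push Not at hm
        have hbB := (List.nodup_cons.1 hn'.2.1.2).1
        have hbu : b ≠ u := by
          rintro rfl
          exact hBX b hvB huX
        have huB : u ∉ B := fun h => hBX u (by simp [h]) huX
        -- Here `b` is the only neighbour of `y` behind `y`, so `b` is itself an articulation point.
        -- Applying `hN` to `b` yields an end in `N` other than `b`.
        have hcl : IsClosedIn G {b} {x | x ∈ B} := by
          refine ⟨?_, ?_⟩
          · rintro x hx rfl
            exact hbB hx
          · intro x hx w hxw hwb
            have hwy : w ∉ ({y} : Set V) := by
              rintro rfl
              exact hm x hx hxw.symm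
            rcases hmem w hwy with h | h
            · exact absurd hxw.symm (hUB w h x (List.mem_cons_of_mem _ hx))
            · exact (List.mem_cons.1 h).resolve_left hwb
        obtain ⟨z, hz⟩ := exists_head?_eq_some hBnil
        obtain ⟨v', hv'N, hv'⟩ := hN b hbu (isVertexCut_of_isClosedIn hcl
          (show z ∈ {x | x ∈ B} from List.mem_of_head? hz) hbu.symm huB)
        obtain ⟨-, hv'b, Y, hY, huY, hv'Y⟩ := inDifferentComponents_iff.1 hv'
        have hv'B : v' ∈ B := by
          by_contra hv'B
          have hv'U : v' ∈ U ++ [y] := by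
            have := hall v'
            simp only [List.mem_append, List.mem_cons] at this
            simp only [List.mem_append, List.mem_singleton]
            have h2 : v' ≠ b := hv'b
            tauto
          refine hv'Y (hY.mem_of_isChain (l := U ++ [y]) ?_ ?_ (by simp [huU]) huY hv'U)
          · have := hl.1
            rw [List.append_cons] at this
            exact this.left_of_append
          · rintro x hx rfl
            rcases List.mem_append.1 hx with hx | hx
            · exact hBX x hvB (hUX x hx)
            · obtain rfl : x = y := by simpa using hx
              exact hBy x hvB rfl
        exact ⟨v', hv'N, by simp [hv'B], b, by simp, hyb, .inl (Ne.symm hv'b)⟩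
      · exact ⟨v, hvN, hvB, b, by simp, hyb, .inl hbv⟩
  obtain ⟨M, hMB, hMm, hMv, hM⟩ := exists_isChain_of_clique hn'.2.1.2 hclique hmB hvB hmv
  have hperm : (U ++ y :: M).Perm (U ++ y :: B) := (hMB.cons y).append_left U
  refine ⟨U ++ y :: M, ⟨?_, hperm.nodup_iff.2 hn⟩, by simp [hUu],
    fun w => hperm.mem_iff.2 (hall w), v, hvN, by simp [List.getLast?_cons, hMv]⟩
  rw [List.isChain_append, List.isChain_cons, hMm]
  refine ⟨hch.1, ⟨by simpa using hym, hM⟩, by simpa using hch.2.2⟩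

/-- Existence of a Hamiltonian path from `u` to a vertex of `N` in a connected graph with
independence number at most two. -/
theorem exists_isPathList_to [Finite V] {N : Set V} (hG : NoIndependentTriple G)
    (hc : G.Preconnected) (hu : ¬ IsArticulationPoint G u)
    (hN : ∀ y, y ≠ u → IsArticulationPoint G y → ∃ v ∈ N, InDifferentComponents G {y} u v)
    (hN' : (∀ y, ¬ IsArticulationPoint G y) → (∃ w, w ≠ u) →
      ∃ v ∈ N, v ≠ u ∧ ¬ IsVertexCut G {u, v})
    (hN'' : (∀ w, w = u) → u ∈ N) :
    ∃ l, IsPathList G l ∧ l.head? = some u ∧ (∀ w, w ∈ l) ∧ ∃ v ∈ N, l.getLast? = some v := by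
  by_cases hart : ∃ y, IsArticulationPoint G y
  · obtain ⟨y, hy⟩ := hart
    have hyu : y ≠ u := by
      rintro rfl
      exact hu hy
    obtain ⟨l, hl, hlu, hall⟩ := exists_isPathList_from hG hc hu
    exact exists_clique_end hG hy hN hyu hl hlu hall
  · push Not at hart
    by_cases hw : ∃ w, w ≠ u
    · obtain ⟨v, hvN, hvu, hcut⟩ := hN' hart hw
      obtain ⟨l, hl, hlu, hlv, hall⟩ := exists_isPathList_between hG hc hart hvu.symm hcut
      exact ⟨l, hl, hlu, hall, v, hvN, hlv⟩
    · push Not at hw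
      exact ⟨[u], ⟨by simp, by simp⟩, rfl, fun w => by simp [hw w], u, hN'' hw, rfl⟩

end SmallIndependence

/-! ### Sufficiency of the conditions -/

section Sufficiency

variable {G : SimpleGraph V} {u : V}

/-- Together with `m`, an independent triple in `Q` would be an independent quadruple of `G`. -/
theorem NoIndependentQuadruple.induce {Q : Set V} {m : V} (hG : NoIndependentQuadruple G)
    (hm : m ∉ Q) (hmQ : ∀ q ∈ Q, ¬ G.Adj m q) : NoIndependentTriple (G.induce Q) := by
  intro a b c hab hac hbc
  have := hG m a b c (by rintro rfl; exact hm a.2) (by rintro rfl; exact hm b.2)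
    (by rintro rfl; exact hm c.2) (Subtype.coe_injective.ne hab) (Subtype.coe_injective.ne hac)
    (Subtype.coe_injective.ne hbc)
  have h1 := hmQ a a.2
  have h2 := hmQ b b.2
  have h3 := hmQ c c.2
  simp only [SimpleGraph.comap_adj, Function.Embedding.subtype_apply]
  tauto

/-- Splitting a Hamiltonian path at an articulation point `x`: one part is the component of
`G - x` containing `u`. -/
theorem isComponentOfDel_of_split {x : V} {L M : List V} (hl : IsPathList G (L ++ x :: M))
    (hall : ∀ v, v ∈ L ++ x :: M) (hx : IsArticulationPoint G x) (hu : u ∈ L) {Q : Set V}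
    (hQ : IsComponentOfDel G {x} Q) (huQ : u ∈ Q) : ∀ v, v ∈ L ↔ v ∈ Q := by
  have hn := hl.2
  have hch := hl.1
  rw [List.isChain_append, List.isChain_cons] at hch
  simp only [List.nodup_append, List.nodup_cons, List.mem_cons] at hn
  have hLx : ∀ v ∈ L, v ∉ ({x} : Set V) := fun v hv => hn.2.2 v hv x (.inl rfl)
  have hMx : ∀ v ∈ M, v ∉ ({x} : Set V) := by
    rintro v hv rfl
    exact hn.2.1.1 hv
  have hmem : ∀ v, v ∉ ({x} : Set V) → v ∈ L ∨ v ∈ M := by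
    intro v hv
    have := hall v
    simp only [List.mem_append, List.mem_cons, Set.mem_singleton_iff] at this hv
    tauto
  have hLQ : ∀ v ∈ L, v ∈ Q := fun v hv => hQ.isClosedIn.mem_of_isChain hch.1 hLx hu huQ hv
  -- Since `x` cuts, some vertex `z` lies outside `Q`. It must be in `M`, which then avoids `Q`
  -- altogether.
  obtain ⟨z, hz⟩ := hx.exists_inDifferentComponents (hLx u hu)
  obtain ⟨-, hzx, X, hX, huX, hzX⟩ := inDifferentComponents_iff.1 hz
  have hzQ : z ∉ Q := fun hzQ => hzX (hQ.subset hX huQ huX hzQ)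
  have hzM : z ∈ M := (hmem z hzx).resolve_left fun h => hzQ (hLQ z h)
  refine fun v => ⟨hLQ v, fun hv => (hmem v (hQ.isClosedIn.1 hv)).resolve_right fun hvM => ?_⟩
  exact hzQ (hQ.isClosedIn.mem_of_isChain hch.2.1.2 hMx hvM hv hzM)

theorem exists_split_before {x : V} {l : List V} (hl : IsPathList G l) (hall : ∀ v, v ∈ l)
    (hxu : x ≠ u) : ∃ L M, IsPathList G (L ++ x :: M) ∧ (∀ v, v ∈ L ++ x :: M) ∧ u ∈ L := by
  obtain ⟨L, M, rfl⟩ := List.append_of_mem (hall x)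
  rcases List.mem_append.1 (hall u) with h | h
  · exact ⟨L, M, hl, hall, h⟩
  · refine ⟨M.reverse, L.reverse, by simpa using hl.reverse, fun v => ?_, ?_⟩
    · have := hall v
      simp only [List.mem_append, List.mem_cons, List.mem_reverse] at this ⊢
      tauto
    · simpa [hxu.symm] using h

/-- Only the part of the given path inside `Q_u` is replaced, by a Hamiltonian path of `G[Q_u]` from
`u` to a neighbour of `x`. -/
theorem exists_isPathList_of_isArticulationPoint [Finite V] (hG : NoIndependentQuadruple G)
    (hu : ¬ IsArticulationPoint G u) (hC : CondC G u) (hD : CondD G u) (hE : CondE G u) {x : V}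
    (hx : IsArticulationPoint G x) {l : List V} (hl : IsPathList G l) (hall : ∀ v, v ∈ l) :
    ∃ l, IsPathList G l ∧ l.head? = some u ∧ ∀ v, v ∈ l := by
  have hxu : x ≠ u := by
    rintro rfl
    exact hu hx
  obtain ⟨L, M, hl, hall, huL⟩ := exists_split_before hl hall hxu
  obtain ⟨Q, hQ, huQ⟩ := exists_isComponentOfDel (G := G) (A := {x}) (u := u) hxu.symm
  have hLQ := isComponentOfDel_of_split hl hall hx huL hQ huQ
  have hn := hl.2
  have hch := hl.1
  rw [List.isChain_append, List.isChain_cons] at hch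
  simp only [List.nodup_append, List.nodup_cons, List.mem_cons] at hn
  have hM : M ≠ [] := by
    rintro rfl
    exact not_isArticulationPoint_of_getLast? hl hall (u := x) (by simp) hx
  obtain ⟨m, hm⟩ := exists_head?_eq_some hM
  have hmM := List.mem_of_head? hm
  have hMQ : ∀ v ∈ M, v ∉ Q := fun v hv hvQ => hn.2.2 v ((hLQ v).2 hvQ) v (.inr hv) rfl
  have hmx : m ∉ ({x} : Set V) := by
    rintro rfl
    exact hn.2.1.1 hmM
  have hxQ : x ∉ Q := fun h => hQ.isClosedIn.1 h rfl
  have htriple : NoIndependentTriple (G.induce Q) := hG.induce (hMQ m hmM) fun q hq hmq =>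
    hMQ m hmM (hQ.isClosedIn.2 q hq m hmq.symm hmx)
  have hum : m ≠ u := fun h => hMQ m hmM (h ▸ huQ)
  -- If `u` cut `G[Q]`, then `G - {u, x}` would have two components in `Q` and a third containing
  -- `m`, against (e).
  have huQ' : ¬ IsArticulationPoint (G.induce Q) ⟨u, huQ⟩ := by
    intro hcut
    obtain ⟨p, q, hpq⟩ := isVertexCut_iff.1 hcut
    obtain ⟨hp, hq, X, hX, hpX, hqX⟩ := inDifferentComponents_iff.1 hpq
    have hp' : (p : V) ≠ u := fun h => hp (Subtype.ext h)
    have hq' : (q : V) ≠ u := fun h => hq (Subtype.ext h)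
    have hnot : ∀ z ∈ Q, z ≠ u → z ∉ ({u, x} : Set V) := by
      rintro z hz hzu (rfl | rfl)
      · exact hzu rfl
      · exact hxQ hz
    have hmux : m ∉ ({u, x} : Set V) := by
      rintro (h | h)
      · exact hum h
      · exact hmx h
    have hcl : IsClosedIn G {u, x} (Subtype.val '' X) := by
      refine ⟨?_, ?_⟩
      · rintro _ ⟨z, hz, rfl⟩
        exact hnot z z.2 fun h => hX.1 hz (Subtype.ext h)
      · rintro _ ⟨z, hz, rfl⟩ w hw hwA
        simp only [Set.mem_insert_iff, Set.mem_singleton_iff, not_or] at hwA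
        have hwQ : w ∈ Q := hQ.isClosedIn.2 z z.2 w hw hwA.2
        exact ⟨⟨w, hwQ⟩, hX.2 z hz _ hw fun h => hwA.1 (congrArg Subtype.val h), rfl⟩
    have hcl' : IsClosedIn G {u, x} (Q \ {u}) := by
      refine ⟨fun z hz => hnot z hz.1 hz.2, ?_⟩
      intro z hz w hw hwA
      simp only [Set.mem_insert_iff, Set.mem_singleton_iff, not_or] at hwA
      exact ⟨hQ.isClosedIn.2 z hz.1 w hw hwA.2, hwA.1⟩
    refine hE ⟨x, three_le_numComponents_iff.2 ⟨p, q, m, ?_, ?_, ?_⟩⟩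
    · refine inDifferentComponents_iff.2 ⟨hnot p p.2 hp', hnot q q.2 hq', _, hcl, ⟨p, hpX, rfl⟩, ?_⟩
      rintro ⟨z, hz, hzq⟩
      rw [Subtype.coe_injective hzq] at hz
      exact hqX hz
    · exact inDifferentComponents_iff.2 ⟨hnot p p.2 hp', hmux, _, hcl', ⟨p.2, hp'⟩,
        fun h => hMQ m hmM h.1⟩
    · exact inDifferentComponents_iff.2 ⟨hnot q q.2 hq', hmux, _, hcl', ⟨q.2, hq'⟩,
        fun h => hMQ m hmM h.1⟩
  have hN₁ : (∀ y, ¬ IsArticulationPoint (G.induce Q) y) → (∃ w : Q, w ≠ ⟨u, huQ⟩) →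
      ∃ v ∈ {v : Q | G.Adj x v}, v ≠ ⟨u, huQ⟩ ∧ ¬ IsVertexCut (G.induce Q) {⟨u, huQ⟩, v} := by
    rintro hart ⟨w, hwu⟩
    by_cases h2 : IsTwoConnected (G.induce Q)
    · obtain ⟨v, hv, hvu, hcut⟩ := hD x hxu hx Q hQ huQ h2
      exact ⟨v, hv, hvu, fun h => hcut (h2.isMinVertexCut_pair h)⟩
    -- Were `u` the only neighbour of `x` in `Q`, it would separate `w` from `x` in `G`.
    · obtain ⟨v, hv, hvu⟩ : ∃ v : Q, G.Adj x v ∧ v ≠ ⟨u, huQ⟩ := by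
        by_contra! hcon
        refine hu (isVertexCut_of_isClosedIn (X := Q \ {u}) (u := w) (v := x) ⟨fun z hz => hz.2, ?_⟩
          ⟨w.2, fun h => hwu (Subtype.ext h)⟩ hxu fun h => hxQ h.1)
        intro z hz y hzy hyu
        refine ⟨hQ.isClosedIn.2 z hz.1 y hzy ?_, hyu⟩
        rintro rfl
        exact hz.2 (congrArg Subtype.val (hcon ⟨z, hz.1⟩ hzy.symm))
      -- A cut `{u, v}` forces a third vertex in `Q`; with no articulation points `G[Q]` would then
      -- be 2-connected.
      refine ⟨v, hv, hvu, fun hcut => h2 (isTwoConnected_iff.2 ⟨hQ.preconnected, ?_, hart⟩)⟩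
      obtain ⟨p, q, hpq⟩ := isVertexCut_iff.1 hcut
      have hp := (inDifferentComponents_iff.1 hpq).1
      simp only [Set.mem_insert_iff, Set.mem_singleton_iff, not_or] at hp
      have := Fintype.ofFinite Q
      rw [Nat.card_eq_fintype_card, Nat.succ_le_iff, Fintype.two_lt_card_iff]
      exact ⟨_, _, _, hvu, Ne.symm hp.2, Ne.symm hp.1⟩
  have hN₂ : (∀ w : Q, w = ⟨u, huQ⟩) → (⟨u, huQ⟩ : Q) ∈ {v : Q | G.Adj x v} := by
    intro hall'
    obtain ⟨c, hc⟩ := exists_getLast?_eq_some (List.ne_nil_of_mem huL)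
    have hcu := congrArg Subtype.val (hall' ⟨c, (hLQ c).1 (List.mem_of_getLast? hc)⟩)
    have hcx : G.Adj c x := hch.2.2 c hc x rfl
    exact (show c = u from hcu) ▸ hcx.symm
  obtain ⟨l', hl', hl'u, hl'all, v, hv, hl'v⟩ := exists_isPathList_to (N := {v : Q | G.Adj x v})
    htriple hQ.preconnected huQ'
    (fun y hyu hy => hC x hxu hx Q hQ huQ
      (fun h => (isTwoConnected_iff.1 h).2.2 y hy) y hyu hy) hN₁ hN₂
  refine ⟨l'.map Subtype.val ++ x :: M, ⟨?_, ?_⟩, ?_, ?_⟩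
  · rw [List.isChain_append, List.isChain_cons]
    refine ⟨hl'.map_val.1, hch.2.1, ?_⟩
    rw [List.getLast?_map, hl'v]
    simpa using (show G.Adj x v from hv).symm
  · rw [List.nodup_append, List.nodup_cons]
    refine ⟨hl'.map_val.2, hn.2.1, ?_⟩
    rintro _ ha b hb rfl
    obtain ⟨z, -, hz⟩ := List.mem_map.1 ha
    rcases List.mem_cons.1 hb with rfl | hb
    · exact hxQ (hz ▸ z.2)
    · exact hMQ _ hb (hz ▸ z.2)
  · rw [List.head?_append, List.head?_map, hl'u]
    rfl
  · intro w
    rcases List.mem_append.1 (hall w) with h | h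
    · exact List.mem_append_left _ (List.mem_map.2 ⟨⟨w, (hLQ w).1 h⟩, hl'all _, rfl⟩)
    · exact List.mem_append_right _ h

/-- A longest path that misses a vertex is not extended; it only reveals a cut `{s, u}`, along which
a Hamiltonian path is assembled afresh. -/
theorem exists_isPathList_of_forall_not_isArticulationPoint [Finite V]
    (hG : NoIndependentQuadruple G) (hc : G.Preconnected) (hart : ∀ v, ¬ IsArticulationPoint G v)
    (hE : CondE G u) (hF : CondF G u) :
    ∃ l, IsPathList G l ∧ l.head? = some u ∧ ∀ v, v ∈ l := by
  obtain ⟨P, hP⟩ := exists_isLongest (G := G) (p := (·.head? = some u)) (l := [u])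
    ⟨by simp, by simp⟩ rfl
  by_cases hPall : ∀ v, v ∈ P
  · exact ⟨P, hP.isPathList, hP.prop, hPall⟩
  push Not at hPall
  obtain ⟨h, hhP⟩ := hPall
  obtain ⟨H, hH, hh⟩ := exists_isLinkedIn (G := G) (A := {x | x ∈ P}) hhP
  have huP : u ∈ P := List.mem_of_head? hP.prop
  have hPH : ∀ z ∈ P, z ∉ H := fun z hz hzH => hH.1.1 hzH hz
  obtain ⟨t, ht⟩ := exists_getLast?_eq_some (List.ne_nil_of_mem huP)
  have htP := List.mem_of_getLast? ht
  have htH := hP.not_touches_getLast hH ht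
  obtain ⟨s₁, hs₁P, hs₁⟩ := exists_touches_of_preconnected hc hH.1 hh
    (show u ∈ {x | x ∈ P} from huP)
  obtain ⟨s₂, hs₂P, hs₂, hne⟩ : ∃ s' ∈ P, Touches G H s' ∧ s' ≠ s₁ := by
    by_contra! hs'
    exact hart s₁ (isVertexCut_of_isClosedIn (v := t) (hH.1.of_touches (by simpa using hs₁P) hs') hh
      (by rintro rfl; exact htH hs₁) (hPH t htP))
  obtain ⟨U, A, B, s₁, s, hPe, hs₁, hs⟩ : ∃ U A B s₁ s₂, P = U ++ s₁ :: (A ++ s₂ :: B) ∧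
      Touches G H s₁ ∧ Touches G H s₂ := by
    obtain ⟨U, A, B, hPe | hPe⟩ := exists_split_pair hs₁P hs₂P hne.symm
    · exact ⟨U, A, B, s₁, s₂, hPe, hs₁, hs₂⟩
    · exact ⟨U, A, B, s₂, s₁, hPe, hs₂, hs₁⟩
  obtain ⟨rfl, a, b, haA, hbB, haH, hbH, hab⟩ := hP.eq_nil_of_touches hG hH hPe hs₁ hs
  obtain rfl : s₁ = u := by simpa [hPe] using hP.prop
  rename' s₁ => u
  have haP : a ∈ P := by simp [hPe, haA]
  have hbP : b ∈ P := by simp [hPe, hbB]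
  have hsP : s ∈ P := by simp [hPe]
  have hn := hP.isPathList.2
  rw [hPe] at hn
  simp only [List.nil_append, List.nodup_cons, List.nodup_append, List.mem_append,
    List.mem_cons, not_or] at hn
  have hab' : a ≠ b := hn.2.2.2 a haA b (.inr hbB)
  have hsu : s ≠ u := fun h => hn.1.2.1 h.symm
  have hbs : b ≠ s := by
    rintro rfl
    exact hn.2.2.1.1 hbB
  have hbu : b ≠ u := by
    rintro rfl
    exact hn.1.2.2 hbB
  -- Of any two attachments the first is `u`, so `s` is the only attachment besides `u`.
  have huniq : ∀ z ∈ {x | x ∈ P}, Touches G H z → z ∈ ({s, u} : Set V) := by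
    intro z hzP hz
    by_contra hzs
    simp only [Set.mem_insert_iff, Set.mem_singleton_iff, not_or] at hzs
    obtain ⟨U, A, B, hPe | hPe⟩ := exists_split_pair hzP hsP hzs.1
    · obtain rfl := (hP.eq_nil_of_touches hG hH hPe hz hs).1
      exact hzs.2 (by simpa [hPe] using hP.prop)
    · obtain rfl := (hP.eq_nil_of_touches hG hH hPe hs hz).1
      exact hsu (by simpa [hPe] using hP.prop)
  have hsub : ({s, u} : Set V) ⊆ {x | x ∈ P} := by
    rintro z (rfl | rfl)
    exacts [hsP, huP]
  have hcl := hH.1.of_touches hsub huniq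
  have hbA : b ∉ ({s, u} : Set V) := by
    rintro (h | h)
    exacts [hbs h, hbu h]
  have hhA : h ∉ ({s, u} : Set V) := hcl.1 hh
  have hcut : IsVertexCut G {s, u} := isVertexCut_of_isClosedIn hcl hh hbA (hPH b hbP)
  have htwo : IsTwoConnected G := by
    refine isTwoConnected_iff.2 ⟨hc, ?_, hart⟩
    have := Fintype.ofFinite V
    rw [Nat.card_eq_fintype_card, Nat.succ_le_iff, Fintype.two_lt_card_iff]
    exact ⟨_, _, _, hsu, hbs.symm, hbu.symm⟩
  have hnum : ¬ 3 ≤ numComponents (del G {s, u}) := fun h3 => hE ⟨s, by rwa [Set.pair_comm]⟩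
  obtain ⟨Q₁, hQ₁, hhQ₁⟩ := exists_isComponentOfDel (G := G) hhA
  obtain ⟨Q₂, hQ₂, hbQ₂⟩ := exists_isComponentOfDel (G := G) hbA
  have hQ₁H : Q₁ ⊆ H := hQ₁.subset hcl hhQ₁ hh
  have hdisj : ∀ z ∈ Q₁, z ∉ Q₂ := fun z hz hz' =>
    hPH b hbP (hQ₁H (hQ₂.subset hQ₁.isClosedIn hz' hz hbQ₂))
  -- Two non-adjacent vertices of `Q₁` would be independent together with `a` and `b`.
  have hclique : G.IsClique Q₁ := by
    intro k hk k' hk' hkk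
    have hkH := hQ₁H hk
    have hkH' := hQ₁H hk'
    have := hG k k' a b hkk (by rintro rfl; exact hPH _ haP hkH) (by rintro rfl; exact hPH _ hbP hkH)
      (by rintro rfl; exact hPH _ haP hkH') (by rintro rfl; exact hPH _ hbP hkH') hab'
    have e1 := not_adj_of_not_touches hkH haH
    have e2 := not_adj_of_not_touches hkH hbH
    have e3 := not_adj_of_not_touches hkH' haH
    have e4 := not_adj_of_not_touches hkH' hbH
    tauto
  have hcover : ∀ z, z ∉ ({s, u} : Set V) → z ∈ Q₁ ∨ z ∈ Q₂ := by
    intro z hz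
    by_contra! hcon
    exact hnum (three_le_numComponents_iff.2 ⟨h, b, z,
      inDifferentComponents_iff.2 ⟨hhA, hbA, Q₁, hQ₁.isClosedIn, hhQ₁, fun h => hdisj b h hbQ₂⟩,
      inDifferentComponents_iff.2 ⟨hhA, hz, Q₁, hQ₁.isClosedIn, hhQ₁, hcon.1⟩,
      inDifferentComponents_iff.2 ⟨hbA, hz, Q₂, hQ₂.isClosedIn, hbQ₂, hcon.2⟩⟩)
  obtain ⟨w, hsw, hw⟩ : ∃ w : Q₂, G.Adj s w ∧ ¬ IsArticulationPoint (G.induce Q₂) w := by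
    by_contra! hcon
    exact hF htwo s u hsu (htwo.isMinVertexCut_pair hcut)
      (le_antisymm (by omega) (two_le_numComponents hcut)) Q₁ Q₂ hQ₁ hQ₂
      (fun hQQ => hdisj h hhQ₁ (hQQ ▸ hhQ₁)) hclique hcon rfl
  obtain ⟨l₂, hl₂, hl₂w, hl₂all⟩ := exists_isPathList_from
    (hG.induce (m := h) (Q := Q₂) (hdisj h hhQ₁) fun q hq hhq =>
      hdisj h hhQ₁ (hQ₂.isClosedIn.2 q hq h hhq.symm hhA)) hQ₂.preconnected hw
  -- If one vertex of the cut had no neighbour in `Q₁`, the other alone would separate `Q₁` from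
  -- `b`.
  have hnbr : ∀ y z : V, ({y, z} : Set V) = {s, u} → ∃ k ∈ Q₁, G.Adj y k := by
    intro y z hyz
    by_contra! hcon
    have hbz : b ∉ ({z} : Set V) := fun h => hbA (hyz ▸ Set.mem_insert_of_mem _ h)
    refine hart z (isVertexCut_of_isClosedIn (X := Q₁) (u := h) (v := b) ⟨?_, ?_⟩ hhQ₁ hbz
      fun h => hdisj b h hbQ₂)
    · intro q hq hqz
      exact hQ₁.isClosedIn.1 hq (hyz ▸ Set.mem_insert_of_mem _ hqz)
    · intro q hq x hqx hxz
      refine hQ₁.isClosedIn.2 q hq x hqx ?_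
      rw [← hyz]
      rintro (rfl | h)
      · exact hcon q hq hqx.symm
      · exact hxz h
  obtain ⟨B₁, hB₁n, hB₁⟩ : ∃ B : List V, B.Nodup ∧ ∀ z, z ∈ B ↔ z ∈ Q₁ :=
    ⟨(Set.toFinite Q₁).toFinset.toList, Finset.nodup_toList _, by simp⟩
  obtain ⟨m, hm, v, hv, hum, hsv, hmv⟩ :
      ∃ m ∈ Q₁, ∃ v ∈ Q₁, G.Adj u m ∧ G.Adj s v ∧ (m ≠ v ∨ B₁ = [v]) := by
    -- Otherwise `u` and `s` have one and the same single neighbour `m` in `Q₁`, and `Q₁` has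
    -- further vertices, so `m` is an articulation point.
    by_contra! hcon
    obtain ⟨m, hm, hum⟩ := hnbr u s (Set.pair_comm _ _)
    obtain ⟨k, hk, hsk⟩ := hnbr s u rfl
    obtain rfl : m = k := (hcon m hm k hk hum hsk).1
    have hB₁m := (hcon m hm m hk hum hsk).2
    obtain ⟨z, hz, hzm⟩ : ∃ z ∈ Q₁, z ≠ m := by
      by_contra! hcon'
      refine hB₁m (List.perm_singleton.1 ?_)
      exact (List.perm_ext_iff_of_nodup hB₁n (by simp)).2 fun z => by
        rw [hB₁, List.mem_singleton]
        exact ⟨hcon' z, by rintro rfl; exact hm⟩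
    have hmu : u ∉ ({m} : Set V) := by
      rintro rfl
      exact G.loopless.irrefl _ hum
    refine hart m (isVertexCut_of_isClosedIn (X := Q₁ \ {m}) (u := z) (v := u) ⟨fun q hq => hq.2, ?_⟩
      ⟨hz, hzm⟩ hmu fun h => hQ₁.isClosedIn.1 h.1 (by simp))
    intro q hq x hqx hxm
    refine ⟨hQ₁.isClosedIn.2 q hq.1 x hqx ?_, hxm⟩
    rintro (rfl | rfl)
    · exact hq.2 (hcon m hm q hq.1 hum hqx.symm).1.symm
    · exact hq.2 (hcon q hq.1 m hm hqx.symm hsk).1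
  obtain ⟨M, hMB, hMm, hMv, hM⟩ := exists_isChain_of_clique hB₁n
    (fun x hx y hy hxy => hclique ((hB₁ x).1 hx) ((hB₁ y).1 hy) hxy) ((hB₁ m).2 hm) ((hB₁ v).2 hv)
    hmv
  have hMQ : ∀ z, z ∈ M ↔ z ∈ Q₁ := fun z => hMB.mem_iff.trans (hB₁ z)
  have hl₂Q : ∀ z, z ∈ l₂.map Subtype.val ↔ z ∈ Q₂ := by
    intro z
    constructor
    · intro hz
      obtain ⟨y, -, rfl⟩ := List.mem_map.1 hz
      exact y.2
    · intro hz
      exact List.mem_map.2 ⟨⟨z, hz⟩, hl₂all _, rfl⟩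
  have hl₂h : (l₂.map Subtype.val).head? = some (w : V) := by
    rw [List.head?_map, hl₂w, Option.map_some]
  refine ⟨u :: (M ++ s :: l₂.map Subtype.val), ⟨?_, ?_⟩, rfl, ?_⟩
  · rw [List.isChain_cons, List.isChain_append, List.isChain_cons, hl₂h, hMv]
    refine ⟨by simpa [hMm] using hum, hM, ⟨by simpa using hsw, hl₂.map_val.1⟩, by simpa using hsv.symm⟩
  · simp only [List.nodup_cons, List.nodup_append, List.mem_append, List.mem_cons, hMQ, hl₂Q]
    refine ⟨?_, hMB.nodup_iff.2 hB₁n, ⟨fun h => hQ₂.isClosedIn.1 h (by simp), hl₂.map_val.2⟩, ?_⟩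
    · rintro (h | h | h)
      · exact hQ₁.isClosedIn.1 h (by simp)
      · exact hsu h.symm
      · exact hQ₂.isClosedIn.1 h (by simp)
    · rintro x hx y (rfl | hy) rfl
      · exact hQ₁.isClosedIn.1 hx (by simp)
      · exact hdisj _ hx hy
  · intro z
    simp only [List.mem_append, List.mem_cons, hMQ, hl₂Q]
    have := hcover z
    simp only [Set.mem_insert_iff, Set.mem_singleton_iff, not_or] at this
    tauto

end Sufficiency

/-! ### Necessity of the conditions -/

section Necessity

variable {G : SimpleGraph V} {u : V}

theorem condC_condD_of_isPathList [Finite V] {l : List V} (hl : IsPathList G l)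
    (hlu : l.head? = some u) (hall : ∀ v, v ∈ l) : CondC G u ∧ CondD G u := by
  -- The segment before `x` is a Hamiltonian path of `G[Q]`; its last vertex serves as `v` in both
  -- conditions. For (c) it lies behind `y`; for (d), deleting both ends leaves a path.
  have key : ∀ x : V, x ≠ u → IsArticulationPoint G x → ∀ Q : Set V, IsComponentOfDel G {x} Q →
      ∀ hu : u ∈ Q, ∃ l : List Q, ∃ v : Q, IsPathList (G.induce Q) l ∧ (∀ w, w ∈ l) ∧
        l.head? = some ⟨u, hu⟩ ∧ l.getLast? = some v ∧ G.Adj x v := by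
    intro x hxu hx Q hQ hu
    obtain ⟨L, M, rfl⟩ := List.append_of_mem (hall x)
    have hL : L ≠ [] := by
      rintro rfl
      exact hxu (by simpa using hlu)
    have hLu : L.head? = some u := by
      obtain ⟨c', hc'⟩ := exists_head?_eq_some hL
      simpa [hc'] using hlu
    obtain ⟨c, hc⟩ := exists_getLast?_eq_some hL
    have hLQ := isComponentOfDel_of_split hl hall hx (List.mem_of_head? hLu) hQ hu
    have hch := hl.1
    rw [List.isChain_append] at hch
    obtain ⟨l', rfl, hl', hl'all⟩ := IsPathList.exists_lift (l := L)
      ⟨hch.1, (List.nodup_append.1 hl.2).1⟩ hLQ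
    have hne : l' ≠ [] := by
      rintro rfl
      exact hL rfl
    obtain ⟨a, ha⟩ := exists_head?_eq_some hne
    obtain ⟨v, hv⟩ := exists_getLast?_eq_some hne
    rw [List.head?_map, ha, Option.map_some, Option.some_inj] at hLu
    refine ⟨l', v, hl', hl'all, by rw [ha]; exact congrArg some (Subtype.ext hLu), hv, ?_⟩
    refine (hch.2.2 v ?_ x rfl).symm
    rw [List.getLast?_map, hv]
    rfl
  constructor
  · intro x hxu hx Q hQ hu _ y hyu hy
    obtain ⟨l, v, hl, hall, hlu, hlv, hxv⟩ := key x hxu hx Q hQ hu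
    refine ⟨v, hxv, ?_⟩
    obtain ⟨U, B, rfl⟩ := List.append_of_mem (hall y)
    have hU : U ≠ [] := by
      rintro rfl
      exact hyu (by simpa using hlu)
    have hB : B ≠ [] := by
      rintro rfl
      exact not_isArticulationPoint_of_getLast? hl hall (by simp) hy
    obtain ⟨c, hc⟩ := exists_head?_eq_some hU
    obtain ⟨d, hd⟩ := exists_getLast?_eq_some hB
    have huU : (⟨u, hu⟩ : Q) ∈ U := by
      refine List.mem_of_head? ?_
      simpa [hc] using hlu
    have hvB : v ∈ B := by
      refine List.mem_of_getLast? ?_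
      simpa [hd, List.getLast?_cons] using hlv
    obtain ⟨Q', hQ', huQ'⟩ := exists_isComponentOfDel (G := G.induce Q) (A := {y})
      (u := ⟨u, hu⟩) (Ne.symm hyu)
    have hUQ := isComponentOfDel_of_split hl hall hy huU hQ' huQ'
    have hn := List.nodup_append.1 hl.2
    refine inDifferentComponents_iff.2 ⟨Ne.symm hyu, ?_, Q', hQ'.isClosedIn, huQ', fun h => ?_⟩
    · rintro rfl
      exact (List.nodup_cons.1 hn.2.1).1 hvB
    · exact hn.2.2 v ((hUQ v).2 h) v (List.mem_cons_of_mem _ hvB) rfl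
  · intro x hxu hx Q hQ hu h2
    obtain ⟨l, v, hl, hall, hlu, hlv, hxv⟩ := key x hxu hx Q hQ hu
    cases l with
    | nil => simp at hlu
    | cons a l =>
      obtain rfl : a = ⟨u, hu⟩ := by simpa using hlu
      have hl0 : l ≠ [] := by
        rintro rfl
        have hcard := (isTwoConnected_iff.1 h2).2.1
        have : Subsingleton Q := ⟨fun x y => by
          have hx := hall x
          have hy := hall y
          rw [List.mem_singleton] at hx hy
          rw [hx, hy]⟩
        have := Finite.card_le_one_iff_subsingleton.2 this
        omega
      obtain ⟨d, hd⟩ := exists_getLast?_eq_some hl0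
      obtain rfl : d = v := by simpa [hd, List.getLast?_cons] using hlv
      obtain ⟨l, rfl⟩ := List.getLast?_eq_some_iff.1 hd
      have hn := hl.2
      simp only [List.nodup_cons, List.nodup_append, List.mem_append, List.mem_singleton,
        not_or] at hn
      refine ⟨d, hxv, Ne.symm hn.1.2, fun hmin => ?_⟩
      refine not_isVertexCut_of_isChain (l := l) hl.1.tail.left_of_append (fun w => ?_) hmin.1
      have hw := hall w
      simp only [List.mem_cons, List.mem_append, List.not_mem_nil, or_false,
        Set.mem_insert_iff, Set.mem_singleton_iff, not_or] at hw ⊢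
      constructor
      · intro hwl
        exact ⟨by rintro rfl; exact hn.1.1 hwl, hn.2.2.2 w hwl d rfl⟩
      · tauto

theorem condE_of_isPathList [Finite V] {l : List V} (hl : IsPathList G l)
    (hlu : l.head? = some u) (hall : ∀ v, v ∈ l) : CondE G u := by
  rintro ⟨x, hx⟩
  obtain ⟨l, rfl⟩ : ∃ l', l = u :: l' := List.head?_eq_some_iff.1 hlu
  have hn := List.nodup_cons.1 hl.2
  -- Condition (e) allows `x = u`, where deleting `u` leaves one segment instead of two.
  by_cases hxu : x = u
  · subst hxu
    refine not_three_le_numComponents_of_isChain (l₁ := l) (l₂ := []) hl.1.tail (by simp)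
      (fun v => ?_) hx
    have := hall v
    simp only [List.mem_cons, List.not_mem_nil, or_false, Set.mem_insert_iff,
      Set.mem_singleton_iff, or_self] at this ⊢
    constructor
    · rintro hv rfl
      exact hn.1 hv
    · tauto
  · have hxl : x ∈ l := (List.mem_cons.1 (hall x)).resolve_left hxu
    obtain ⟨A, B, rfl⟩ := List.append_of_mem hxl
    refine not_three_le_numComponents_of_isChain (l₁ := A) (l₂ := B) hl.1.tail.left_of_append
      hl.1.tail.right_of_append.tail (fun v => ?_) hx
    have := hall v
    simp only [List.nodup_append, List.nodup_cons, List.mem_append, List.mem_cons, not_or] at hn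
    simp only [List.mem_append, List.mem_cons, Set.mem_insert_iff,
      Set.mem_singleton_iff, not_or] at this ⊢
    constructor
    · rintro (hv | hv)
      · exact ⟨by rintro rfl; exact hn.1.1 hv, hn.2.2.2 v hv x (.inl rfl)⟩
      · exact ⟨by rintro rfl; exact hn.1.2.2 hv, by rintro rfl; exact hn.2.2.1.1 hv⟩
    · tauto

theorem condF_of_isPathList {l : List V} (hl : IsPathList G l)
    (hlu : l.head? = some u) (hall : ∀ v, v ∈ l) : CondF G u := by
  rintro - x y hxy - - Q₁ Q₂ hQ₁ hQ₂ hne - hart rfl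
  obtain ⟨l, rfl⟩ : ∃ l', l = u :: l' := List.head?_eq_some_iff.1 hlu
  have hn := List.nodup_cons.1 hl.2
  have hxl : x ∈ l := (List.mem_cons.1 (hall x)).resolve_left hxy
  obtain ⟨A, B, rfl⟩ := List.append_of_mem hxl
  simp only [List.nodup_append, List.nodup_cons, List.mem_append, List.mem_cons, not_or] at hn
  have hch := hl.1.tail
  simp only [List.tail_cons, List.isChain_append, List.isChain_cons] at hch
  have hAx : ∀ v ∈ A, v ∉ ({x, u} : Set V) := by
    rintro v hv (rfl | rfl)
    · exact hn.2.2.2 v hv v (.inl rfl) rfl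
    · exact hn.1.1 hv
  have hBx : ∀ v ∈ B, v ∉ ({x, u} : Set V) := by
    rintro v hv (rfl | rfl)
    · exact hn.2.2.1.1 hv
    · exact hn.1.2.2 hv
  have hmem : ∀ v, v ∉ ({x, u} : Set V) → v ∈ A ∨ v ∈ B := by
    intro v hv
    have := hall v
    simp only [List.mem_append, List.mem_cons, Set.mem_insert_iff, Set.mem_singleton_iff,
      not_or] at this hv
    tauto
  obtain ⟨q₁, hq₁⟩ := hQ₁.nonempty
  obtain ⟨q₂, hq₂⟩ := hQ₂.nonempty
  have hq₁Q₂ : q₁ ∉ Q₂ := fun h => hne ((hQ₁.subset hQ₂.isClosedIn hq₁ h).antisymm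
    (hQ₂.subset hQ₁.isClosedIn h hq₁))
  -- A segment meeting `Q₂` spans it, so its end next to `x` is no articulation point of `G[Q₂]`,
  -- contrary to `hart`. The segment after `x` is used reversed, so that this end comes last.
  have key : ∀ A B : List V, A.IsChain G.Adj → B.IsChain G.Adj → A.Nodup →
      (∀ v ∈ A, v ∉ ({x, u} : Set V)) → (∀ v ∈ B, v ∉ ({x, u} : Set V)) →
      (∀ v, v ∉ ({x, u} : Set V) → v ∈ A ∨ v ∈ B) → (∀ a, A.getLast? = some a → G.Adj x a) →
      q₂ ∉ A := by
    intro A B hA hB hAn hAx hBx hmem hlast hq₂A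
    have hAQ : ∀ v ∈ A, v ∈ Q₂ := fun v hv => hQ₂.isClosedIn.mem_of_isChain hA hAx hq₂A hq₂ hv
    have hq₁B : q₁ ∈ B := (hmem q₁ (hQ₁.isClosedIn.1 hq₁)).resolve_left fun h => hq₁Q₂ (hAQ _ h)
    have hAQ' : ∀ v, v ∈ A ↔ v ∈ Q₂ := fun v => ⟨hAQ v, fun hv =>
      (hmem v (hQ₂.isClosedIn.1 hv)).resolve_right fun hvB =>
        hq₁Q₂ (hQ₂.isClosedIn.mem_of_isChain hB hBx hvB hv hq₁B)⟩
    obtain ⟨l', rfl, hl', hl'all⟩ := IsPathList.exists_lift (l := A) ⟨hA, hAn⟩ hAQ'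
    have hne : l' ≠ [] := by
      rintro rfl
      simp at hq₂A
    obtain ⟨v, hv⟩ := exists_getLast?_eq_some hne
    refine not_isArticulationPoint_of_getLast? hl' hl'all hv (hart v (hlast v ?_))
    rw [List.getLast?_map, hv]
    rfl
  rcases hmem q₂ (hQ₂.isClosedIn.1 hq₂) with h | h
  · exact key A B hch.1 hch.2.1.2 hn.2.1 hAx hBx hmem
      (fun a ha => (hch.2.2 a ha x rfl).symm) h
  · refine key B.reverse A (isChain_reverse_adj.2 hch.2.1.2) hch.1
      (List.nodup_reverse.2 hn.2.2.1.2) (by simpa using hBx) hAx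
      (fun v hv => by simpa using (hmem v hv).symm) (fun a ha => hch.2.1.1 a ?_) (by simpa using h)
    simpa using ha

end Necessity

end HamPath

theorem theorem5 {V : Type*} [Fintype V] [DecidableEq V] (G : SimpleGraph V)
    (hconn : G.Connected) (hfree : HamPath.IsKK1Free 4 G) (u : V) :
    HamPath.HasHamPathFrom G u ↔
      HamPath.HasHamPath G ∧
      ¬ HamPath.IsArticulationPoint G u ∧
      HamPath.CondC G u ∧
      HamPath.CondD G u ∧
      HamPath.CondE G u ∧
      HamPath.CondF G u := by
  open HamPath in
  constructor
  · intro h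
    obtain ⟨l, hl, hlu, hall⟩ := hasHamPathFrom_iff.1 h
    have hCD := condC_condD_of_isPathList hl hlu hall
    exact ⟨⟨u, h⟩, not_isArticulationPoint_of_head? hl hall hlu, hCD.1, hCD.2,
      condE_of_isPathList hl hlu hall, condF_of_isPathList hl hlu hall⟩
  · rintro ⟨⟨w, hw⟩, hB, hC, hD, hE, hF⟩
    have hG := IsKK1Free.noIndependentQuadruple hfree
    rw [hasHamPathFrom_iff]
    by_cases hart : ∃ x, IsArticulationPoint G x
    · obtain ⟨x, hx⟩ := hart
      obtain ⟨l, hl, -, hall⟩ := hasHamPathFrom_iff.1 hw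
      exact exists_isPathList_of_isArticulationPoint hG hB hC hD hE hx hl hall
    · push Not at hart
      exact exists_isPathList_of_forall_not_isArticulationPoint hG hconn.preconnected hart hE hF
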